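/- Let $k_n=2^n$ and consider the dyadic system $X_0=0$, $\dot X_n=k_{n-1}X_{n-1}^2-k_nX_nX_{n+1}$ $(n\ge 1)$. A positive solution is a family of continuously differentiable functions on $[0,\infty)$ with non-negative values satisfying all these equations; it has finite energy if $\sum_n X_n(t)^2<\infty$ for all $t\ge 0$. Put $\beta=2^{-1/3}$. **Theorem.** There is exactly one real sequence $(d_k)_{k\ge -1}$ with $d_{-1}=-1$ and $$\sum_{i=-1}^{k+1}d_id_{k-i}\,(4-\beta^{2k+2i})=2d_k\beta^{2k}\qquad(k\ge -1);$$ it satisfies $d_k\ge 0$ for $k\ge 0$, and the radius of convergence $R$ of $\sum_{k\ge 0}d_kx^k$ lies in $(4/5,1)$. The function $h(x)=-\sum_{k=-1}^{\infty}d_kx^k=\frac1x-\sum_{k\ge 0}d_kx^k$ on $(0,R)$ extends to a strictly decreasing bijection $h:(0,R]\to[0,\infty)$. Let $\gamma=h(\beta^2R)$. 1. For every $t_0<0$ and every integer $n_0\ge 0$ there is exactly one positive finite-energy solution of the self-similar form $X_n(t)=\frac{a_n}{t-t_0}$ with $a_1=\dots=a_{n_0}=0$ and $a_{n_0+1}\ne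 0$. It solves the system on all of $(t_0,\infty)$, its coefficients are $a_n=2^{-n}h(\beta^{2(n-n_0)}R)$ for $n>n_0$, and $$\lim_{n\to\infty}\frac{a_n}{k_n^{-1/3}}=C_{n_0}:=\frac{\beta^{2n_0}}{R}.$$ 2. For every $t_0<0$ and $n_0\ge 0$, a real sequence $(a_n)_{n\ge 0}$ is the coefficient sequence of a positive self-similar solution $X_n(t)=\frac{a_n}{t-t_0}$ (of finite energy or not) with $a_1=\dots=a_{n_0}=0$, $a_{n_0+1}\neq 0$ if and only if $$a_0=\dots=a_{n_0}=0,\qquad a_{n_0+1}>0,\qquad a_{n+1}=2^{-n}+\frac{a_{n-1}^2}{2a_n}\quad(n\ge n_0+1).\tag{$*$}$$ 3. For every $n_0\geq 0$, $\gamma$ is the unique real number such that every sequence $(a_n)$ satisfying $(*)$ is square summable if and only if $\tilde a_1:=2^{n_0+1}a_{n_0+1}=\gamma$. 4. Let $n_0\ge 0$ and let $(a_n)$ satisfy $(*)$. If $(a_n)$ is square summable, then $a_n=2^{-n}h(\beta^{2(n-n_0)}R)$ for all $n>n_0$, and $a_n\sim C_{n_0}\beta^n=C_{n_0}2^{-n/3}$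 as $n\to\infty$. Otherwise the odd-indexed or the even-indexed coefficients diverge to $+\infty$ faster than every exponential (for one $p\in\{0,1\}$, $a_{2k+p}/M^k\to+\infty$ for every $M>0$), and the power series $\sum_n a_nz^n$ has radius of convergence $0$. -/

import Mathlib

open Set Filter Topology Asymptotics

/-- The wave numbers `k_n = 2^n` of the dyadic model. -/
def waveNumber (n : ℕ) : ℝ := 2 ^ n

/-- `X` is a componentwise solution, on the time set `I`, of the unforced inviscid dyadic model
`X_0 = 0`, `X_n' = k_{n-1} X_{n-1}^2 - k_n X_n X_{n+1}` for `n ≥ 1`: all components are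
continuously differentiable on `I` (one-sided derivatives at end points that belong to `I`), and
all the equations hold on `I`. -/
structure IsComponentwiseSolutionOn (I : Set ℝ) (X : ℕ → ℝ → ℝ) : Prop where
  zero : ∀ t ∈ I, X 0 t = 0
  contDiffOn : ∀ n, ContDiffOn ℝ 1 (X n) I
  equation : ∀ n, 1 ≤ n → ∀ t ∈ I,
    HasDerivWithinAt (X n)
      (waveNumber (n - 1) * X (n - 1) t ^ 2 - waveNumber n * X n t * X (n + 1) t) I t

/-- A positive componentwise solution on `[0, ∞)`: every component is non-negative for every
`t ≥ 0`. -/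
def IsPositiveSolution (X : ℕ → ℝ → ℝ) : Prop :=
  IsComponentwiseSolutionOn (Ici 0) X ∧ ∀ t : ℝ, 0 ≤ t → ∀ n, 0 ≤ X n t

/-- The space `H` of square summable sequences. -/
def SquareSummable (u : ℕ → ℝ) : Prop := Summable fun n => u n ^ 2

/-- Finite energy: `X(t) ∈ H` for all `t ≥ 0`. -/
def HasFiniteEnergy (X : ℕ → ℝ → ℝ) : Prop :=
  ∀ t : ℝ, 0 ≤ t → SquareSummable fun n => X n t

/-- The self-similar family `X_n(t) = a_n / (t - t₀)`. -/
noncomputable def selfSimilar (t₀ : ℝ) (a : ℕ → ℝ) : ℕ → ℝ → ℝ :=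
  fun n t => a n / (t - t₀)

/-- `a_1 = … = a_{n₀} = 0` and `a_{n₀+1} ≠ 0`. -/
def StartsAfter (n₀ : ℕ) (a : ℕ → ℝ) : Prop :=
  (∀ n, 1 ≤ n → n ≤ n₀ → a n = 0) ∧ a (n₀ + 1) ≠ 0

/-- The recurrence of the coefficients of positive self-similar solutions:
`a_0 = … = a_{n₀} = 0`, `a_{n₀+1} > 0` and `a_{n+1} = 2^{-n} + a_{n-1}^2 / (2 a_n)` for
`n ≥ n₀ + 1`. -/
structure IsCoefficientSequence (n₀ : ℕ) (a : ℕ → ℝ) : Prop where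
  eq_zero : ∀ n, n ≤ n₀ → a n = 0
  pos : 0 < a (n₀ + 1)
  recurrence : ∀ n, n₀ + 1 ≤ n → a (n + 1) = (2 ^ n)⁻¹ + a (n - 1) ^ 2 / (2 * a n)

/-- The rescaled coefficients `ã_n = 2^{n+n₀} a_{n+n₀}`. -/
def rescaled (n₀ : ℕ) (a : ℕ → ℝ) (n : ℕ) : ℝ := 2 ^ (n + n₀) * a (n + n₀)

/-- `β = 2^{-1/3}`. -/
noncomputable def beta : ℝ := (2 : ℝ) ^ (-(1 / 3) : ℝ)

/-- The relations for `(d_k)_{k ≥ -1}`: `d_{-1} = -1` and, for all `k ≥ -1`,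
`∑_{i=-1}^{k+1} d_i d_{k-i} (4 - β^{2k+2i}) = 2 d_k β^{2k}`.
The values at indices below `-1` carry no meaning and are set to `0`. -/
structure IsSeriesCoefficients (d : ℤ → ℝ) : Prop where
  eq_zero : ∀ k, k < -1 → d k = 0
  neg_one : d (-1) = -1
  relation : ∀ k, -1 ≤ k →
    ∑ i ∈ Finset.Icc (-1) (k + 1), d i * d (k - i) * (4 - beta ^ (2 * k + 2 * i))
      = 2 * d k * beta ^ (2 * k)

/-- The radius of convergence of the real power series `∑ c_n x^n`. -/
noncomputable def convergenceRadius (c : ℕ → ℝ) : ENNReal :=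
  (FormalMultilinearSeries.ofScalars ℝ c).radius

/-- One of the two subsequences (of odd or of even indices) of `a` diverges to `+∞` faster than
any exponential. -/
def DivergesSuperExponentially (a : ℕ → ℝ) : Prop :=
  ∃ p : ℕ, (p = 0 ∨ p = 1) ∧
    ∀ M : ℝ, 0 < M → Tendsto (fun k : ℕ => a (2 * k + p) / M ^ k) atTop atTop

/-!
The rescaled coefficients `ã_n = 2^(n + n₀) a_(n + n₀)` satisfy `ã_0 = 0` and
`ã_(n + 2) = 2 + 4 ã_n² / ã_(n + 1)`. With `q = β²`, so that `q⁻³ = 4`, one solution is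
`s_n = h(q^n R)`, where `h` solves `h(q x) (h(q² x) - 2) = q⁻³ h(x)²` and `h(R) = 0`. For
`x h(x) = 1 - F(x)` this functional equation is the recursion for the `d_k`, and it forces the
coefficients of `F` to be non-negative. It also expresses `(1 - F)²` through `F(q x)` and `F(q² x)`,
so `(1 - F)²` converges on a larger disc than `F`. Its square root continues `F` past every point at
which `F < 1`, hence `F` reaches the value `1`, and it does so at its radius of convergence `R`.

If another solution `b` has `b_1 ≠ s_1`, then by the monotonicity of the recurrence `b` lies
alternately above and below `s` from some index on, and at the indices where it is above, the excess
of `b_n / s_n` over `1` is amplified geometrically. As `s_(n + 1) / s_n` is bounded, this makes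
`b_(n + 2) / b_n` tend to infinity along those indices, hence the super-exponential divergence. The
sequence `s` itself gives `a_n ~ C β^n`, which is square summable.
-/

section PowerSeries

open scoped PowerSeries
open PowerSeries (coeff C)

/-- Convergence of the power series `f` at the real point `x`; as `ℝ` is finite-dimensional, this is
absolute convergence. -/
def SummableAt (f : ℝ⟦X⟧) (x : ℝ) : Prop := Summable fun n => coeff n f * x ^ n

/-- The sum of the power series `f` at `x`, with junk value `0` where `f` does not converge. -/
noncomputable def seriesSum (f : ℝ⟦X⟧) (x : ℝ) : ℝ := ∑' n, coeff n f * x ^ n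

/-- The power series `f` converges at `x` with sum `a`. -/
def HasValueAt (f : ℝ⟦X⟧) (x a : ℝ) : Prop := HasSum (fun n => coeff n f * x ^ n) a

/-- The sum of the first `N` terms, of degrees `0, …, N - 1`, of the power series `f` at `x`. -/
noncomputable def partialSum (f : ℝ⟦X⟧) (N : ℕ) (x : ℝ) : ℝ :=
  ∑ n ∈ Finset.range N, coeff n f * x ^ n

variable {f g : ℝ⟦X⟧} {x y r a b : ℝ}

theorem SummableAt.hasValueAt (hf : SummableAt f x) : HasValueAt f x (seriesSum f x) :=
  hf.hasSum

namespace HasValueAt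

theorem summableAt (hf : HasValueAt f x a) : SummableAt f x := hf.summable

theorem eq_of_hasValueAt (hf : HasValueAt f x a) (hf' : HasValueAt f x b) : a = b := hf.unique hf'

theorem sub (hf : HasValueAt f x a) (hg : HasValueAt g x b) : HasValueAt (f - g) x (a - b) :=
  (HasSum.sub hf hg).congr_fun fun n => by rw [map_sub, sub_mul]

theorem one (x : ℝ) : HasValueAt 1 x 1 :=
  (hasSum_ite_eq 0 (1 : ℝ)).congr_fun fun n => by
    rw [PowerSeries.coeff_one]; split_ifs with h <;> simp [h]

theorem C_mul_X (c x : ℝ) : HasValueAt (C c * PowerSeries.X) x (c * x) :=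
  (hasSum_ite_eq 1 (c * x)).congr_fun fun n => by
    rw [PowerSeries.coeff_C_mul, PowerSeries.coeff_X]; split_ifs with h <;> simp [h]

theorem rescale {c : ℝ} (hf : HasValueAt f (c * x) a) :
    HasValueAt (PowerSeries.rescale c f) x a :=
  HasSum.congr_fun hf fun n => by rw [PowerSeries.coeff_rescale, mul_pow]; ring

theorem mul (hf : HasValueAt f x a) (hg : HasValueAt g x b) : HasValueAt (f * g) x (a * b) := by
  have hprod := (summable_norm_sum_mul_antidiagonal_of_summable_norm
    hf.summable.norm hg.summable.norm).of_norm.hasSum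
  rw [← tsum_mul_tsum_eq_tsum_sum_antidiagonal_of_summable_norm hf.summable.norm hg.summable.norm,
    hf.tsum_eq, hg.tsum_eq] at hprod
  refine hprod.congr_fun fun n => ?_
  rw [PowerSeries.coeff_mul, Finset.sum_mul]
  refine Finset.sum_congr rfl fun p hp => ?_
  rw [← Finset.HasAntidiagonal.mem_antidiagonal.1 hp, pow_add]
  ring

end HasValueAt

theorem SummableAt.tendsto_partialSum (hf : SummableAt f x) :
    Tendsto (partialSum f · x) atTop (𝓝 (seriesSum f x)) :=
  hf.hasSum.tendsto_sum_nat

theorem continuous_partialSum (f : ℝ⟦X⟧) (N : ℕ) : Continuous (partialSum f N) := by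
  unfold partialSum
  fun_prop

theorem norm_coeff_mul_pow_le (f : ℝ⟦X⟧) (hx : |x| ≤ r) (n : ℕ) :
    ‖coeff n f * x ^ n‖ ≤ ‖coeff n f * r ^ n‖ := by
  rw [norm_mul, norm_mul, norm_pow, norm_pow]
  exact mul_le_mul_of_nonneg_left (pow_le_pow_left₀ (norm_nonneg x) (hx.trans (le_abs_self r)) n)
    (norm_nonneg _)

theorem SummableAt.of_abs_le (hf : SummableAt f r) (hx : |x| ≤ r) : SummableAt f x :=
  hf.norm.of_norm_bounded (norm_coeff_mul_pow_le f hx)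

theorem SummableAt.of_le (hf : SummableAt f r) (hx : 0 ≤ x) (hxr : x ≤ r) : SummableAt f x :=
  hf.of_abs_le ((abs_of_nonneg hx).trans_le hxr)

theorem SummableAt.tendstoUniformlyOn (hf : SummableAt f r) :
    TendstoUniformlyOn (partialSum f) (seriesSum f) atTop (Icc (-r) r) :=
  tendstoUniformlyOn_tsum_nat hf.norm fun n _ hx =>
    norm_coeff_mul_pow_le f (abs_le.2 hx) n

theorem SummableAt.continuousOn_seriesSum (hf : SummableAt f r) :
    ContinuousOn (seriesSum f) (Icc (-r) r) :=
  hf.tendstoUniformlyOn.continuousOn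
    (Frequently.of_forall fun N => (continuous_partialSum f N).continuousOn)

theorem convergenceRadius_eq_ofReal {c : ℕ → ℝ} {R : ℝ} (hR : 0 < R)
    (hs : Summable fun n => c n * R ^ n) (hns : ∀ ρ, R < ρ → ¬ Summable fun n => c n * ρ ^ n) :
    convergenceRadius c = ENNReal.ofReal R := by
  refine le_antisymm (le_of_not_gt fun h => ?_)
    (FormalMultilinearSeries.le_radius_of_summable _ ?_)
  · obtain ⟨ρ, hRρ, hρ⟩ := ENNReal.lt_iff_exists_nnreal_btwn.1 h
    rw [← ENNReal.ofReal_coe_nnreal, ENNReal.ofReal_lt_ofReal_iff_of_nonneg hR.le] at hRρ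
    refine hns ρ hRρ (Summable.of_norm ?_)
    have hsum := FormalMultilinearSeries.summable_norm_mul_pow _ hρ
    simpa only [FormalMultilinearSeries.ofScalars_norm, norm_mul, norm_pow, NNReal.norm_eq]
      using hsum
  · simpa only [FormalMultilinearSeries.ofScalars_norm, Real.coe_toNNReal _ hR.le, norm_mul,
      norm_pow, Real.norm_of_nonneg hR.le] using hs.norm

/-- The set of all `x ≥ 0` at which no partial sum of `f` exceeds `1`. For a series with
non-negative coefficients this says that `f` converges at `x` with sum at most `1`. -/
def subunitSet (f : ℝ⟦X⟧) : Set ℝ := {x | 0 ≤ x ∧ ∀ N, partialSum f N x ≤ 1}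

/-- The largest point of `subunitSet f`, if there is one. -/
noncomputable def unitRadius (f : ℝ⟦X⟧) : ℝ := sSup (subunitSet f)

theorem isClosed_subunitSet (f : ℝ⟦X⟧) : IsClosed (subunitSet f) := by
  rw [subunitSet, ofPred_and, ofPred_forall]
  exact isClosed_Ici.inter
    (isClosed_iInter fun N => isClosed_le (continuous_partialSum f N) continuous_const)

theorem zero_mem_subunitSet (hf0 : coeff 0 f = 0) : 0 ∈ subunitSet f := by
  refine ⟨le_rfl, fun N => le_trans (Finset.sum_nonpos fun n _ => ?_) zero_le_one⟩
  rcases n with _ | n <;> simp [hf0]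

theorem bddAbove_subunitSet (hf0 : coeff 0 f = 0) (hf1 : 0 < coeff 1 f) :
    BddAbove (subunitSet f) := by
  refine ⟨1 / coeff 1 f, fun x hx => ?_⟩
  have hsum := hx.2 2
  rw [partialSum, Finset.sum_range_succ, Finset.sum_range_one, hf0, zero_mul, zero_add,
    pow_one] at hsum
  rwa [le_div_iff₀' hf1]

theorem unitRadius_mem (hf0 : coeff 0 f = 0) (hf1 : 0 < coeff 1 f) :
    unitRadius f ∈ subunitSet f :=
  (isClosed_subunitSet f).csSup_mem ⟨0, zero_mem_subunitSet hf0⟩ (bddAbove_subunitSet hf0 hf1)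

section NonnegCoeff

variable (hf : ∀ n, 0 ≤ coeff n f)
include hf

theorem partialSum_nonneg (hx : 0 ≤ x) (N : ℕ) : 0 ≤ partialSum f N x :=
  Finset.sum_nonneg fun n _ => mul_nonneg (hf n) (pow_nonneg hx n)

theorem partialSum_mono (hx : 0 ≤ x) : Monotone (partialSum f · x) := fun _ _ hMN =>
  Finset.sum_le_sum_of_subset_of_nonneg (Finset.range_mono hMN) fun n _ _ =>
    mul_nonneg (hf n) (pow_nonneg hx n)

theorem seriesSum_nonneg (hx : 0 ≤ x) : 0 ≤ seriesSum f x :=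
  tsum_nonneg fun n => mul_nonneg (hf n) (pow_nonneg hx n)

theorem SummableAt.partialSum_le_seriesSum (hs : SummableAt f x) (hx : 0 ≤ x) (N : ℕ) :
    partialSum f N x ≤ seriesSum f x :=
  hs.sum_le_tsum _ fun n _ => mul_nonneg (hf n) (pow_nonneg hx n)

theorem strictMonoOn_seriesSum (hf1 : 0 < coeff 1 f) (hs : SummableAt f r) :
    StrictMonoOn (seriesSum f) (Icc 0 r) := fun x hx y hy hxy =>
  (hs.of_le hx.1 hx.2).tsum_lt_tsum (i := 1)
    (fun n => mul_le_mul_of_nonneg_left (pow_le_pow_left₀ hx.1 hxy.le n) (hf n))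
    (by simpa only [pow_one] using mul_lt_mul_of_pos_left hxy hf1) (hs.of_le hy.1 hy.2)

theorem seriesSum_mul_le_pow_mul {k : ℕ} (hk : ∀ n < k, coeff n f = 0) (hs : SummableAt f x)
    (hx : 0 ≤ x) {t : ℝ} (ht : t ∈ Icc (0 : ℝ) 1) :
    seriesSum f (t * x) ≤ t ^ k * seriesSum f x := by
  have htx : SummableAt f (t * x) :=
    hs.of_le (mul_nonneg ht.1 hx) (mul_le_of_le_one_left hx ht.2)
  rw [seriesSum, seriesSum, ← tsum_mul_left]
  refine htx.tsum_le_tsum (fun n => ?_) (hs.mul_left _)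
  rcases lt_or_ge n k with hn | hn
  · simp [hk n hn]
  · rw [mul_pow, mul_left_comm]
    exact mul_le_mul_of_nonneg_right (pow_le_pow_of_le_one ht.1 ht.2 hn)
      (mul_nonneg (hf n) (pow_nonneg hx n))

theorem partialSum_mul_le (hg : ∀ n, 0 ≤ coeff n g) (hf0 : coeff 0 f = 0) (hg0 : coeff 0 g = 0)
    (hx : 0 ≤ x) (N : ℕ) :
    partialSum (f * g) (N + 1) x ≤ partialSum f N x * partialSum g N x := by
  let F : ℕ × ℕ → ℝ := fun p => coeff p.1 f * x ^ p.1 * (coeff p.2 g * x ^ p.2)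
  have hF p : 0 ≤ F p :=
    mul_nonneg (mul_nonneg (hf _) (pow_nonneg hx _)) (mul_nonneg (hg _) (pow_nonneg hx _))
  have hterm (n : ℕ) : coeff n (f * g) * x ^ n =
      ∑ p ∈ Finset.HasAntidiagonal.antidiagonal n, F p := by
    rw [PowerSeries.coeff_mul, Finset.sum_mul]
    refine Finset.sum_congr rfl fun p hp => ?_
    rw [← Finset.HasAntidiagonal.mem_antidiagonal.1 hp, pow_add]
    ring
  have hdiag n (hn : n ∈ Finset.range (N + 1)) : coeff n (f * g) * x ^ n =
      ∑ p ∈ Finset.range N ×ˢ Finset.range N with p.1 + p.2 = n, F p := by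
    rw [hterm]
    refine (Finset.sum_subset (fun p hp => ?_) fun p hp hp' => ?_).symm
    · exact Finset.HasAntidiagonal.mem_antidiagonal.2 (Finset.mem_filter.1 hp).2
    simp only [Finset.HasAntidiagonal.mem_antidiagonal] at hp
    simp only [Finset.mem_filter, Finset.mem_product, Finset.mem_range, hp, and_true] at hp' hn
    rcases Nat.eq_zero_or_pos p.1 with h | _
    · simp [F, h, hf0]
    rcases Nat.eq_zero_or_pos p.2 with h | _
    · simp [F, h, hg0]
    omega
  rw [partialSum, partialSum, partialSum, Finset.sum_mul_sum, ← Finset.sum_product',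
    Finset.sum_congr rfl hdiag]
  exact Finset.sum_fiberwise_le_sum_of_sum_fiber_nonneg fun _ _ =>
    Finset.sum_nonneg fun p _ => hF p

theorem two_mul_partialSum_succ_le (hf0 : coeff 0 f = 0) (hx : 0 ≤ x) (N : ℕ) :
    2 * partialSum f (N + 1) x ≤
      1 - partialSum ((1 - f) ^ 2) (N + 1) x + partialSum f N x ^ 2 := by
  have hsq : partialSum ((1 - f) ^ 2) (N + 1) x =
      1 - 2 * partialSum f (N + 1) x + partialSum (f * f) (N + 1) x := by
    have hone : partialSum 1 (N + 1) x = 1 := by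
      simp [partialSum, PowerSeries.coeff_one]
    rw [← hone, show (1 - f) ^ 2 = 1 - f - f + f * f by ring]
    simp only [partialSum, map_add, map_sub, add_mul, sub_mul, Finset.sum_add_distrib,
      Finset.sum_sub_distrib]
    ring
  have hmul := partialSum_mul_le hf hf hf0 hf0 hx N
  rw [sq (partialSum f N x)]
  linarith

/-- Write `S_N` and `H_N` for the partial sums of `f` and `(1 - f)^2`. If `f(r) < σ < 1`, then
`H_N ≥ (1 - σ)^2` for large `N`, uniformly near `r`, because `(1 - f)^2` converges beyond `r`; hence
`S_N ≤ σ` propagates from `N` to `N + 1` by `2 S_{N+1} ≤ 1 - H_{N+1} + S_N^2`. -/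
theorem exists_gt_mem_subunitSet (hf0 : coeff 0 f = 0) (hr : 0 ≤ r) {ρ : ℝ} (hrρ : r < ρ)
    (hs : SummableAt f r) (hlt : seriesSum f r < 1) (hsq : SummableAt ((1 - f) ^ 2) ρ) :
    ∃ y, r < y ∧ y ∈ subunitSet f := by
  obtain ⟨σ, hfσ, hσ1⟩ := exists_between hlt
  have hrmem : Icc (-ρ) ρ ∈ 𝓝 r := Icc_mem_nhds (by linarith) hrρ
  have hval : seriesSum ((1 - f) ^ 2) r = (1 - seriesSum f r) ^ 2 := by
    have h1 := (HasValueAt.one r).sub hs.hasValueAt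
    rw [sq, sq]
    exact (h1.mul h1).tsum_eq
  have hsq_lt : (1 - σ) ^ 2 < seriesSum ((1 - f) ^ 2) r := by
    rw [hval]
    exact pow_lt_pow_left₀ (by linarith) (by linarith) two_ne_zero
  obtain ⟨v, hσv, hvr⟩ := exists_between hsq_lt
  have hnear : ∀ᶠ y in 𝓝 r, v < seriesSum ((1 - f) ^ 2) y :=
    (hsq.continuousOn_seriesSum.continuousAt hrmem).eventually_const_lt hvr
  obtain ⟨N₀, hN₀⟩ := eventually_atTop.1
    (Metric.tendstoUniformlyOn_iff.1 hsq.tendstoUniformlyOn (v - (1 - σ) ^ 2) (by linarith))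
  have hbase : ∀ᶠ y in 𝓝 r, partialSum f N₀ y < σ :=
    (continuous_partialSum f N₀).continuousAt.eventually_lt_const
      ((hs.partialSum_le_seriesSum hf hr N₀).trans_lt hfσ)
  obtain ⟨y, ⟨⟨hyv, hyρ⟩, hyσ⟩, hry⟩ :=
    (((hnear.and hrmem).and hbase).filter_mono nhdsWithin_le_nhds |>.and
      (self_mem_nhdsWithin : Ioi r ∈ 𝓝[>] r)).exists
  have hy : 0 ≤ y := hr.trans (le_of_lt hry)
  have hstep : ∀ N ≥ N₀, partialSum f N y ≤ σ := by
    refine fun N hN => Nat.le_induction hyσ.le (fun M hM ih => ?_) N hN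
    have hdist := hN₀ (M + 1) (hM.trans M.le_succ) y hyρ
    rw [Real.dist_eq] at hdist
    have hquad := two_mul_partialSum_succ_le hf hf0 hy M
    have hmul := pow_le_pow_left₀ (partialSum_nonneg hf hy M) ih 2
    linarith [(abs_lt.1 hdist).2]
  exact ⟨y, hry, hy, fun N => (partialSum_mono hf hy (le_max_left N N₀)).trans
    ((hstep _ (le_max_right N N₀)).trans hσ1.le)⟩

theorem summableAt_unitRadius (hf0 : coeff 0 f = 0) (hf1 : 0 < coeff 1 f) :
    SummableAt f (unitRadius f) :=
  have hmem := unitRadius_mem hf0 hf1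
  summable_of_sum_range_le (fun n => mul_nonneg (hf n) (pow_nonneg hmem.1 n)) hmem.2

theorem seriesSum_unitRadius (hf0 : coeff 0 f = 0) (hf1 : 0 < coeff 1 f) {ρ : ℝ}
    (hρ : unitRadius f < ρ) (hsq : SummableAt ((1 - f) ^ 2) ρ) :
    seriesSum f (unitRadius f) = 1 := by
  have hmem := unitRadius_mem hf0 hf1
  have hs := summableAt_unitRadius hf hf0 hf1
  refine le_antisymm (le_of_tendsto' hs.tendsto_partialSum hmem.2) (not_lt.1 fun hlt => ?_)
  obtain ⟨y, hy, hymem⟩ := exists_gt_mem_subunitSet hf hf0 hmem.1 hρ hs hlt hsq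
  exact hy.not_ge (le_csSup (bddAbove_subunitSet hf0 hf1) hymem)

end NonnegCoeff

end PowerSeries

theorem sum_antidiagonal_succ_eq_ends_add {M : Type*} [AddCommMonoid M] (φ : ℕ × ℕ → M) (n : ℕ) :
    ∑ p ∈ Finset.HasAntidiagonal.antidiagonal (n + 1), φ p =
      φ (0, n + 1) + φ (n + 1, 0) + ∑ k ∈ Finset.range n, φ (k + 1, n - k) := by
  rw [Finset.Nat.sum_antidiagonal_eq_sum_range_succ_mk, Finset.sum_range_succ,
    Finset.sum_range_succ']
  simp only [Nat.add_sub_add_right, Nat.sub_self, Nat.sub_zero]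
  abel

section FormalProfile

open scoped PowerSeries
open PowerSeries (coeff rescale C X)

/-- For `h(x) = G(x) / x` this is the functional equation `h(qx) (h(q²x) - 2) = q⁻³ h(x)²`,
multiplied by `q³ x²` and read as an identity between formal power series; `G` is normalised to have
constant coefficient `1`. -/
structure IsFormalProfile (q : ℝ) (G : ℝ⟦X⟧) : Prop where
  coeff_zero : coeff 0 G = 1
  sq_eq : G ^ 2 = rescale q G * (rescale (q ^ 2) G - C (2 * q ^ 2) * X)

variable {q : ℝ} {G G' : ℝ⟦X⟧}

theorem coeff_succ_rescale_mul_rescale_sub (G : ℝ⟦X⟧) (q : ℝ) (n : ℕ) :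
    coeff (n + 1) (rescale q G * (rescale (q ^ 2) G - C (2 * q ^ 2) * X)) =
      ∑ p ∈ Finset.HasAntidiagonal.antidiagonal (n + 1),
        coeff p.1 G * coeff p.2 G * q ^ (p.1 + 2 * p.2) - 2 * q ^ (n + 2) * coeff n G := by
  rw [mul_sub, map_sub, mul_left_comm, PowerSeries.coeff_C_mul, PowerSeries.coeff_succ_mul_X,
    PowerSeries.coeff_rescale, PowerSeries.coeff_mul]
  congr 1
  · refine Finset.sum_congr rfl fun p _ => ?_
    rw [PowerSeries.coeff_rescale, PowerSeries.coeff_rescale, pow_add, pow_mul]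
    ring
  · ring

theorem isFormalProfile_iff_sum_antidiagonal :
    IsFormalProfile q G ↔ coeff 0 G = 1 ∧ ∀ n,
      ∑ p ∈ Finset.HasAntidiagonal.antidiagonal (n + 1),
        coeff p.1 G * coeff p.2 G * (1 - q ^ (p.1 + 2 * p.2)) = -(2 * q ^ (n + 2) * coeff n G) := by
  have hcoeff n : coeff (n + 1) (G ^ 2) = coeff (n + 1)
        (rescale q G * (rescale (q ^ 2) G - C (2 * q ^ 2) * X)) ↔
      ∑ p ∈ Finset.HasAntidiagonal.antidiagonal (n + 1),
        coeff p.1 G * coeff p.2 G * (1 - q ^ (p.1 + 2 * p.2)) =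
          -(2 * q ^ (n + 2) * coeff n G) := by
    rw [coeff_succ_rescale_mul_rescale_sub, sq G, PowerSeries.coeff_mul]
    simp only [mul_sub, mul_one, Finset.sum_sub_distrib]
    constructor <;> intro h <;> linarith
  refine ⟨fun h => ⟨h.coeff_zero, fun n => (hcoeff n).1 (congrArg _ h.sq_eq)⟩,
    fun h => ⟨h.1, PowerSeries.ext fun n => ?_⟩⟩
  rcases n with _ | n
  · rw [sq G, mul_sub, mul_left_comm, map_sub, PowerSeries.coeff_C_mul,
      PowerSeries.coeff_zero_mul_X, mul_zero, sub_zero, PowerSeries.coeff_mul,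
      PowerSeries.coeff_mul]
    simp only [Finset.Nat.antidiagonal_zero, Finset.sum_singleton, PowerSeries.coeff_rescale,
      pow_zero, one_mul]
  · exact (hcoeff n).2 (h.2 n)

theorem isFormalProfile_iff_recurrence :
    IsFormalProfile q G ↔ coeff 0 G = 1 ∧ ∀ n,
      coeff (n + 1) G * (2 - q ^ (n + 1) - q ^ (2 * (n + 1))) =
        -(∑ k ∈ Finset.range n, coeff (k + 1) G * coeff (n - k) G *
            (1 - q ^ (k + 1 + 2 * (n - k))) + 2 * q ^ (n + 2) * coeff n G) := by
  rw [isFormalProfile_iff_sum_antidiagonal]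
  refine and_congr_right fun h0 => forall_congr' fun n => ?_
  rw [sum_antidiagonal_succ_eq_ends_add, h0]
  simp only [zero_add, mul_zero, add_zero]
  constructor <;> intro h <;> linarith

theorem two_sub_pow_sub_pow_pos (hq : q ∈ Ioo (0 : ℝ) 1) (n : ℕ) :
    0 < 2 - q ^ (n + 1) - q ^ (2 * (n + 1)) := by
  have hpow : q ^ (n + 1) < 1 := pow_lt_one₀ hq.1.le hq.2 n.succ_ne_zero
  have hpow' : q ^ (2 * (n + 1)) < 1 := pow_lt_one₀ hq.1.le hq.2 (by omega)
  linarith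

theorem IsFormalProfile.unique (hq : q ∈ Ioo (0 : ℝ) 1) (hG : IsFormalProfile q G)
    (hG' : IsFormalProfile q G') : G = G' := by
  rw [isFormalProfile_iff_recurrence] at hG hG'
  refine PowerSeries.ext fun n => ?_
  induction n using Nat.strong_induction_on with
  | _ n ih =>
    rcases n with _ | n
    · rw [hG.1, hG'.1]
    refine mul_right_cancel₀ (two_sub_pow_sub_pow_pos hq n).ne' ?_
    rw [hG.2, hG'.2, ih n n.lt_succ_self]
    congr 2
    refine Finset.sum_congr rfl fun k hk => ?_
    rw [ih (k + 1) (by simpa using hk), ih (n - k) (by omega)]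

/-- The coefficients of the unique formal profile. -/
noncomputable def formalProfileCoeff (q : ℝ) : ℕ → ℝ
  | 0 => 1
  | n + 1 =>
    -(∑ k : Fin n, formalProfileCoeff q (k + 1) * formalProfileCoeff q (n - k) *
        (1 - q ^ (k + 1 + 2 * (n - k) : ℕ)) + 2 * q ^ (n + 2) * formalProfileCoeff q n) /
      (2 - q ^ (n + 1) - q ^ (2 * (n + 1)))

/-- The power series `F` for which `1 - F` is the formal profile; it has non-negative coefficients,
and for `q = β²` its coefficient of degree `m ≥ 1` is the `d_{m-1}` of the theorem. -/
noncomputable def dyadicSeries (q : ℝ) : ℝ⟦X⟧ := 1 - PowerSeries.mk (formalProfileCoeff q)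

theorem isFormalProfile_one_sub_dyadicSeries (hq : q ∈ Ioo (0 : ℝ) 1) :
    IsFormalProfile q (1 - dyadicSeries q) := by
  rw [dyadicSeries, sub_sub_cancel, isFormalProfile_iff_recurrence]
  refine ⟨by rw [PowerSeries.coeff_mk, formalProfileCoeff], fun n => ?_⟩
  simp only [PowerSeries.coeff_mk]
  rw [formalProfileCoeff, div_mul_cancel₀ _ (two_sub_pow_sub_pow_pos hq n).ne',
    Fin.sum_univ_eq_sum_range (fun k => formalProfileCoeff q (k + 1) *
      formalProfileCoeff q (n - k) * (1 - q ^ (k + 1 + 2 * (n - k) : ℕ)))]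

theorem coeff_zero_dyadicSeries (q : ℝ) : coeff 0 (dyadicSeries q) = 0 := by
  rw [dyadicSeries, map_sub, PowerSeries.coeff_mk, formalProfileCoeff, PowerSeries.coeff_zero_one,
    sub_self]

theorem coeff_one_sub_dyadicSeries {n : ℕ} (hn : n ≠ 0) :
    coeff n (1 - dyadicSeries q) = -coeff n (dyadicSeries q) := by
  rw [map_sub, PowerSeries.coeff_one, if_neg hn, zero_sub]

theorem dyadicSeries_recurrence (hq : q ∈ Ioo (0 : ℝ) 1) (n : ℕ) :
    coeff (n + 1) (dyadicSeries q) * (2 - q ^ (n + 1) - q ^ (2 * (n + 1))) =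
      ∑ k ∈ Finset.range n, coeff (k + 1) (dyadicSeries q) * coeff (n - k) (dyadicSeries q) *
        (1 - q ^ (k + 1 + 2 * (n - k))) + 2 * q ^ (n + 2) * coeff n (1 - dyadicSeries q) := by
  have hrec := (isFormalProfile_iff_recurrence.1 (isFormalProfile_one_sub_dyadicSeries hq)).2 n
  rw [coeff_one_sub_dyadicSeries n.succ_ne_zero, neg_mul, neg_inj] at hrec
  rw [hrec]
  congr 1
  refine Finset.sum_congr rfl fun k hk => ?_
  have hnk : n - k ≠ 0 := Nat.sub_ne_zero_of_lt (Finset.mem_range.1 hk)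
  rw [coeff_one_sub_dyadicSeries k.succ_ne_zero, coeff_one_sub_dyadicSeries hnk, neg_mul_neg]

theorem coeff_one_dyadicSeries_mul (hq : q ∈ Ioo (0 : ℝ) 1) :
    coeff 1 (dyadicSeries q) * (2 - q - q ^ 2) = 2 * q ^ 2 := by
  have hrec := dyadicSeries_recurrence hq 0
  rwa [Finset.sum_range_zero, (isFormalProfile_one_sub_dyadicSeries hq).coeff_zero, zero_add,
    zero_add, pow_one, mul_one, zero_add, mul_one] at hrec

theorem coeff_one_dyadicSeries_pos (hq : q ∈ Ioo (0 : ℝ) 1) : 0 < coeff 1 (dyadicSeries q) := by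
  have hpos := two_sub_pow_sub_pow_pos hq 0
  rw [zero_add, pow_one, mul_one] at hpos
  refine pos_of_mul_pos_left ?_ hpos.le
  rw [coeff_one_dyadicSeries_mul hq]
  exact mul_pos two_pos (pow_pos hq.1 2)

theorem two_mul_pow_le_coeff_one_mul (hq : q ∈ Ioo (0 : ℝ) 1) {m : ℕ} (hm : 3 ≤ m) :
    2 * q ^ m ≤ coeff 1 (dyadicSeries q) * (1 - q ^ m) := by
  have hpow : q ^ m ≤ q ^ 3 := pow_le_pow_of_le_one hq.1.le hq.2.le hm
  have hpos := coeff_one_dyadicSeries_pos hq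
  calc 2 * q ^ m ≤ 2 * q ^ 3 := by linarith
    _ = coeff 1 (dyadicSeries q) * (q * (2 - q - q ^ 2)) := by
      linear_combination (-q) * coeff_one_dyadicSeries_mul hq
    _ ≤ coeff 1 (dyadicSeries q) * (1 - q ^ 3) :=
      mul_le_mul_of_nonneg_left (by linarith [sq_nonneg (1 - q)]) hpos.le
    _ ≤ coeff 1 (dyadicSeries q) * (1 - q ^ m) :=
      mul_le_mul_of_nonneg_left (by linarith) hpos.le

/-- In the recursion the only negative term is `-2 q^(n+2) e_n`; it is outweighed by the summand
`e_n e_1 (1 - q^(n+2))` of the convolution. -/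
theorem coeff_dyadicSeries_nonneg (hq : q ∈ Ioo (0 : ℝ) 1) (n : ℕ) :
    0 ≤ coeff n (dyadicSeries q) := by
  induction n using Nat.strong_induction_on with
  | _ n ih =>
    rcases n with _ | _ | n
    · exact (coeff_zero_dyadicSeries q).ge
    · exact (coeff_one_dyadicSeries_pos hq).le
    refine nonneg_of_mul_nonneg_left ?_ (two_sub_pow_sub_pow_pos hq (n + 1))
    have hsum : 0 ≤ ∑ k ∈ Finset.range n, coeff (k + 1) (dyadicSeries q) *
        coeff (n + 1 - k) (dyadicSeries q) * (1 - q ^ (k + 1 + 2 * (n + 1 - k))) := by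
      refine Finset.sum_nonneg fun k hk => mul_nonneg (mul_nonneg (ih _ ?_) (ih _ ?_))
        (sub_nonneg.2 (pow_le_one₀ hq.1.le hq.2.le))
      · have := Finset.mem_range.1 hk; omega
      · omega
    have hlast := mul_le_mul_of_nonneg_left (two_mul_pow_le_coeff_one_mul hq
      (show 3 ≤ n + 3 by omega)) (ih (n + 1) (by omega))
    rw [dyadicSeries_recurrence hq, Finset.sum_range_succ,
      coeff_one_sub_dyadicSeries n.succ_ne_zero, Nat.add_sub_cancel_left, mul_one]
    linarith

theorem coeff_succ_dyadicSeries_mul_le (hq : q ∈ Ioo (0 : ℝ) 1) (n : ℕ) :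
    coeff (n + 1) (dyadicSeries q) * (2 - q - q ^ 2) ≤
      coeff (n + 1) (dyadicSeries q * dyadicSeries q) + if n = 0 then 2 * q ^ 2 else 0 := by
  have hnonneg := coeff_dyadicSeries_nonneg hq
  have hpow : q ^ (n + 1) ≤ q := pow_le_of_le_one hq.1.le hq.2.le n.succ_ne_zero
  have hpow' : q ^ (2 * (n + 1)) ≤ q ^ 2 := pow_le_pow_of_le_one hq.1.le hq.2.le (by omega)
  refine (mul_le_mul_of_nonneg_left (by linarith) (hnonneg (n + 1))).trans
    ((dyadicSeries_recurrence hq n).trans_le ?_)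
  rw [PowerSeries.coeff_mul, sum_antidiagonal_succ_eq_ends_add]
  simp only [coeff_zero_dyadicSeries, zero_mul, mul_zero, zero_add]
  refine add_le_add (Finset.sum_le_sum fun k _ => ?_) ?_
  · exact mul_le_of_le_one_right (mul_nonneg (hnonneg _) (hnonneg _))
      (sub_le_self _ (pow_nonneg hq.1.le _))
  · split_ifs with hn
    · rw [hn, (isFormalProfile_one_sub_dyadicSeries hq).coeff_zero, zero_add, mul_one]
    · rw [coeff_one_sub_dyadicSeries hn, mul_neg, neg_nonpos]
      exact mul_nonneg (mul_nonneg two_pos.le (pow_nonneg hq.1.le _)) (hnonneg n)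

theorem partialSum_dyadicSeries_mul_le (hq : q ∈ Ioo (0 : ℝ) 1) {x : ℝ} (hx : 0 ≤ x) (N : ℕ) :
    partialSum (dyadicSeries q) (N + 1) x * (2 - q - q ^ 2) ≤
      partialSum (dyadicSeries q) N x ^ 2 + 2 * q ^ 2 * x := by
  have hnonneg := coeff_dyadicSeries_nonneg hq
  have h0 := coeff_zero_dyadicSeries q
  have hlinear : ∑ n ∈ Finset.range N, (if n = 0 then 2 * q ^ 2 else 0) * x ^ (n + 1) ≤
      2 * q ^ 2 * x := by
    simp only [ite_mul, zero_mul, Finset.sum_ite_eq', zero_add, pow_one]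
    split_ifs
    · rfl
    · exact mul_nonneg (mul_nonneg two_pos.le (sq_nonneg q)) hx
  calc partialSum (dyadicSeries q) (N + 1) x * (2 - q - q ^ 2)
      = ∑ n ∈ Finset.range N,
          coeff (n + 1) (dyadicSeries q) * (2 - q - q ^ 2) * x ^ (n + 1) := by
        rw [partialSum, Finset.sum_range_succ', h0, zero_mul, add_zero, Finset.sum_mul]
        exact Finset.sum_congr rfl fun n _ => by ring
    _ ≤ ∑ n ∈ Finset.range N, (coeff (n + 1) (dyadicSeries q * dyadicSeries q) +
          if n = 0 then 2 * q ^ 2 else 0) * x ^ (n + 1) :=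
        Finset.sum_le_sum fun n _ =>
          mul_le_mul_of_nonneg_right (coeff_succ_dyadicSeries_mul_le hq n) (pow_nonneg hx _)
    _ ≤ partialSum (dyadicSeries q * dyadicSeries q) (N + 1) x + 2 * q ^ 2 * x := by
        simp only [add_mul, Finset.sum_add_distrib]
        refine add_le_add (le_of_eq ?_) hlinear
        simp [partialSum, Finset.sum_range_succ', PowerSeries.coeff_mul, h0]
    _ ≤ partialSum (dyadicSeries q) N x ^ 2 + 2 * q ^ 2 * x := by
        rw [sq (partialSum _ N x)]
        exact add_le_add_left (partialSum_mul_le hnonneg hnonneg h0 h0 hx N) _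

/-- With `δ = 2 - q - q²`, the quadratic bound keeps all partial sums at `δ² / 8` below `δ / 2`. -/
theorem exists_pos_mem_subunitSet_dyadicSeries (hq : q ∈ Ioo (0 : ℝ) 1) :
    ∃ x, 0 < x ∧ x ∈ subunitSet (dyadicSeries q) := by
  obtain ⟨δ, hδ⟩ : ∃ δ, δ = 2 - q - q ^ 2 := ⟨_, rfl⟩
  have hq2 : q ^ 2 < 1 := pow_lt_one₀ hq.1.le hq.2 two_ne_zero
  have hδ0 : 0 < δ := by linarith [hq.2]
  have hx : 0 ≤ δ ^ 2 / 8 := by positivity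
  have hbound N : partialSum (dyadicSeries q) N (δ ^ 2 / 8) ≤ δ / 2 := by
    induction N with
    | zero => simpa [partialSum] using (half_pos hδ0).le
    | succ N ih =>
      refine le_of_mul_le_mul_right ?_ hδ0
      have hstep := partialSum_dyadicSeries_mul_le hq hx N
      have hsq := pow_le_pow_left₀ (partialSum_nonneg (coeff_dyadicSeries_nonneg hq) hx N) ih 2
      have hlin := mul_le_mul_of_nonneg_right hq2.le hx
      rw [← hδ] at hstep
      linarith
  exact ⟨δ ^ 2 / 8, by positivity, hx,
    fun N => (hbound N).trans (by linarith [hq.1, sq_nonneg q])⟩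

end FormalProfile

section Profile

open scoped PowerSeries
open PowerSeries (coeff C X)

/-- The positive zero of `x ↦ x h(x)`; it is also the radius of convergence of `dyadicSeries q`. -/
noncomputable def dyadicRadius (q : ℝ) : ℝ := unitRadius (dyadicSeries q)

/-- The function `x ↦ x h(x)`. -/
noncomputable def profileNum (q x : ℝ) : ℝ := 1 - seriesSum (dyadicSeries q) x

/-- The function `h` of the theorem for `q = β²`, with junk value `0` at `0`. -/
noncomputable def profile (q x : ℝ) : ℝ := profileNum q x / x

theorem SummableAt.hasValueAt_profileNum {q x : ℝ} (hs : SummableAt (dyadicSeries q) x) :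
    HasValueAt (1 - dyadicSeries q) x (profileNum q x) :=
  (HasValueAt.one x).sub hs.hasValueAt

variable {q : ℝ} (hq : q ∈ Ioo (0 : ℝ) 1) {x : ℝ}
include hq

theorem SummableAt.hasValueAt_one_sub_dyadicSeries_sq (hx : 0 ≤ x)
    (hs : SummableAt (dyadicSeries q) (q * x)) :
    HasValueAt ((1 - dyadicSeries q) ^ 2) x
      (profileNum q (q * x) * (profileNum q (q ^ 2 * x) - 2 * q ^ 2 * x)) := by
  have hs' : SummableAt (dyadicSeries q) (q ^ 2 * x) :=
    hs.of_le (mul_nonneg (sq_nonneg q) hx)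
      (mul_le_mul_of_nonneg_right (pow_le_of_le_one hq.1.le hq.2.le two_ne_zero) hx)
  rw [(isFormalProfile_one_sub_dyadicSeries hq).sq_eq]
  exact hs.hasValueAt_profileNum.rescale.mul
    (hs'.hasValueAt_profileNum.rescale.sub (HasValueAt.C_mul_X _ x))

theorem profileNum_sq (hx : 0 ≤ x) (hs : SummableAt (dyadicSeries q) x) :
    profileNum q x ^ 2 =
      profileNum q (q * x) * (profileNum q (q ^ 2 * x) - 2 * q ^ 2 * x) := by
  have hs' : SummableAt (dyadicSeries q) (q * x) :=
    hs.of_le (mul_nonneg hq.1.le hx) (mul_le_of_le_one_left hx hq.2.le)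
  refine HasValueAt.eq_of_hasValueAt ?_ (hs'.hasValueAt_one_sub_dyadicSeries_sq hq hx)
  rw [sq, sq]
  exact hs.hasValueAt_profileNum.mul hs.hasValueAt_profileNum

theorem dyadicRadius_pos : 0 < dyadicRadius q := by
  obtain ⟨x, hx, hmem⟩ := exists_pos_mem_subunitSet_dyadicSeries hq
  exact hx.trans_le (le_csSup
    (bddAbove_subunitSet (coeff_zero_dyadicSeries q) (coeff_one_dyadicSeries_pos hq)) hmem)

theorem summableAt_dyadicRadius : SummableAt (dyadicSeries q) (dyadicRadius q) :=
  summableAt_unitRadius (coeff_dyadicSeries_nonneg hq) (coeff_zero_dyadicSeries q)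
    (coeff_one_dyadicSeries_pos hq)

/-- By the functional equation `(1 - F)²` still converges at `R / q`. -/
theorem seriesSum_dyadicRadius : seriesSum (dyadicSeries q) (dyadicRadius q) = 1 := by
  have hR := dyadicRadius_pos hq
  have hs : SummableAt (dyadicSeries q) (q * (dyadicRadius q / q)) := by
    rw [mul_div_cancel₀ _ hq.1.ne']
    exact summableAt_dyadicRadius hq
  exact seriesSum_unitRadius (coeff_dyadicSeries_nonneg hq) (coeff_zero_dyadicSeries q)
    (coeff_one_dyadicSeries_pos hq) ((lt_div_iff₀ hq.1).2 (mul_lt_of_lt_one_right hR hq.2))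
    (hs.hasValueAt_one_sub_dyadicSeries_sq hq (div_pos hR hq.1).le).summableAt

theorem profileNum_dyadicRadius : profileNum q (dyadicRadius q) = 0 := by
  rw [profileNum, seriesSum_dyadicRadius hq, sub_self]

theorem pow_mul_dyadicRadius_mem (n : ℕ) : q ^ n * dyadicRadius q ∈ Ioc 0 (dyadicRadius q) :=
  have hR := dyadicRadius_pos hq
  ⟨mul_pos (pow_pos hq.1 n) hR, mul_le_of_le_one_left hR.le (pow_le_one₀ hq.1.le hq.2.le)⟩

theorem strictAntiOn_profileNum : StrictAntiOn (profileNum q) (Icc 0 (dyadicRadius q)) :=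
  fun _ hx _ hy hxy => sub_lt_sub_left (strictMonoOn_seriesSum (coeff_dyadicSeries_nonneg hq)
    (coeff_one_dyadicSeries_pos hq) (summableAt_dyadicRadius hq) hx hy hxy) 1

theorem profileNum_pos (hx : 0 ≤ x) (hxR : x < dyadicRadius q) : 0 < profileNum q x :=
  profileNum_dyadicRadius hq ▸
    strictAntiOn_profileNum hq ⟨hx, hxR.le⟩ ⟨(dyadicRadius_pos hq).le, le_rfl⟩ hxR

theorem continuousOn_profileNum : ContinuousOn (profileNum q) (Icc 0 (dyadicRadius q)) :=
  (continuousOn_const.sub (summableAt_dyadicRadius hq).continuousOn_seriesSum).mono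
    (Icc_subset_Icc_left (neg_nonpos.2 (dyadicRadius_pos hq).le))

theorem profileNum_le_one (hx : 0 ≤ x) : profileNum q x ≤ 1 :=
  sub_le_self _ (seriesSum_nonneg (coeff_dyadicSeries_nonneg hq) hx)

theorem one_sub_div_le_profileNum (hx : x ∈ Icc 0 (dyadicRadius q)) :
    1 - x / dyadicRadius q ≤ profileNum q x := by
  have hR := dyadicRadius_pos hq
  have hpow := seriesSum_mul_le_pow_mul (coeff_dyadicSeries_nonneg hq) (k := 1)
    (fun n hn => by rw [Nat.lt_one_iff.1 hn, coeff_zero_dyadicSeries])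
    (summableAt_dyadicRadius hq) hR.le (t := x / dyadicRadius q)
    ⟨div_nonneg hx.1 hR.le, (div_le_one hR).2 hx.2⟩
  rw [div_mul_cancel₀ _ hR.ne', seriesSum_dyadicRadius hq, pow_one, mul_one] at hpow
  exact sub_le_sub_left hpow 1

theorem tendsto_profileNum_pow_mul :
    Tendsto (fun n => profileNum q (q ^ n * dyadicRadius q)) atTop (𝓝 1) := by
  have hlower : Tendsto (fun n => 1 - q ^ n) atTop (𝓝 1) := by
    simpa using (tendsto_pow_atTop_nhds_zero_of_lt_one hq.1.le hq.2).const_sub 1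
  refine tendsto_of_tendsto_of_tendsto_of_le_of_le hlower tendsto_const_nhds (fun n => ?_)
    fun n => profileNum_le_one hq (pow_mul_dyadicRadius_mem hq n).1.le
  have hmem := pow_mul_dyadicRadius_mem hq n
  have hle := one_sub_div_le_profileNum hq ⟨hmem.1.le, hmem.2⟩
  rwa [mul_div_cancel_right₀ _ (dyadicRadius_pos hq).ne'] at hle

theorem profileNum_sq_mul_dyadicRadius :
    profileNum q (q ^ 2 * dyadicRadius q) = 2 * q ^ 2 * dyadicRadius q := by
  have hR := dyadicRadius_pos hq
  have hsq := profileNum_sq hq hR.le (summableAt_dyadicRadius hq)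
  have hpos : 0 < profileNum q (q * dyadicRadius q) :=
    profileNum_pos hq (mul_pos hq.1 hR).le (mul_lt_of_lt_one_left hR hq.2)
  rw [profileNum_dyadicRadius hq, zero_pow two_ne_zero, zero_eq_mul] at hsq
  exact sub_eq_zero.1 (hsq.resolve_left hpos.ne')

/-- Beyond `R` the functional equation would make a square negative. -/
theorem not_summableAt_dyadicSeries {ρ : ℝ} (hρ : dyadicRadius q < ρ) :
    ¬ SummableAt (dyadicSeries q) ρ := by
  intro hs
  have hR := dyadicRadius_pos hq
  obtain ⟨y, hRy, hy⟩ := exists_between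
    (lt_min hρ ((lt_div_iff₀ hq.1).2 (mul_lt_of_lt_one_right hR hq.2)))
  have hy0 : 0 < y := hR.trans hRy
  have hqy : q * y < dyadicRadius q :=
    (lt_div_iff₀' hq.1).1 (hy.trans_le (min_le_right _ _))
  have hq2y : q ^ 2 * y ≤ dyadicRadius q := hqy.le.trans' <|
    mul_le_mul_of_nonneg_right (pow_le_of_le_one hq.1.le hq.2.le two_ne_zero) hy0.le
  have hlt : q ^ 2 * dyadicRadius q < q ^ 2 * y := mul_lt_mul_of_pos_left hRy (pow_pos hq.1 2)
  have hanti := strictAntiOn_profileNum hq ⟨by positivity, hlt.le.trans hq2y⟩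
    ⟨by positivity, hq2y⟩ hlt
  rw [profileNum_sq_mul_dyadicRadius hq] at hanti
  have hneg := mul_neg_of_pos_of_neg (profileNum_pos hq (mul_pos hq.1 hy0).le hqy)
    (show profileNum q (q ^ 2 * y) - 2 * q ^ 2 * y < 0 by linarith)
  rw [← profileNum_sq hq hy0.le (hs.of_le hy0.le (hy.le.trans (min_le_left _ _)))] at hneg
  exact hneg.not_ge (sq_nonneg _)

theorem convergenceRadius_dyadicSeries :
    convergenceRadius (fun n => coeff (n + 1) (dyadicSeries q)) =
      ENNReal.ofReal (dyadicRadius q) := by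
  have hiff {ρ : ℝ} (hρ : 0 < ρ) : Summable (fun n => coeff (n + 1) (dyadicSeries q) * ρ ^ n) ↔
      SummableAt (dyadicSeries q) ρ := by
    rw [SummableAt, ← summable_nat_add_iff 1 (f := fun n => coeff n (dyadicSeries q) * ρ ^ n),
      ← summable_mul_right_iff hρ.ne' (f := fun n => coeff (n + 1) (dyadicSeries q) * ρ ^ n)]
    simp only [pow_succ, mul_assoc]
  have hR := dyadicRadius_pos hq
  exact convergenceRadius_eq_ofReal hR ((hiff hR).2 (summableAt_dyadicRadius hq)) fun ρ hρ h =>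
    not_summableAt_dyadicSeries hq hρ ((hiff (hR.trans hρ)).1 h)

theorem dyadicRadius_mul_le_one :
    dyadicRadius q * (q ^ 2 * (2 + coeff 1 (dyadicSeries q))) ≤ 1 := by
  have hmem := pow_mul_dyadicRadius_mem hq 2
  have hterm := ((summableAt_dyadicRadius hq).of_le hmem.1.le hmem.2).le_tsum 1
    fun n _ => mul_nonneg (coeff_dyadicSeries_nonneg hq n) (pow_nonneg hmem.1.le n)
  have hval := profileNum_sq_mul_dyadicRadius hq
  rw [profileNum, seriesSum] at hval
  rw [pow_one] at hterm
  linarith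

/-- Shrinking the argument from `R` to `q² R` shrinks the part of `F` of order at least two by the
factor `q⁴`. -/
theorem one_sub_pow_four_le_dyadicRadius_mul :
    1 - q ^ 4 ≤ dyadicRadius q *
      (2 * q ^ 2 + coeff 1 (dyadicSeries q) * (q ^ 2 - q ^ 4)) := by
  set e := coeff 1 (dyadicSeries q)
  have hmem := pow_mul_dyadicRadius_mem hq 2
  have hs := summableAt_dyadicRadius hq
  have htail {x : ℝ} (hx : SummableAt (dyadicSeries q) x) :
      HasValueAt (dyadicSeries q - C e * X) x (seriesSum (dyadicSeries q) x - e * x) :=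
    hx.hasValueAt.sub (HasValueAt.C_mul_X e x)
  have hsum {x : ℝ} (hx : SummableAt (dyadicSeries q) x) :
      seriesSum (dyadicSeries q - C e * X) x = seriesSum (dyadicSeries q) x - e * x :=
    (htail hx).tsum_eq
  have hcoeff n : coeff n (dyadicSeries q - C e * X) =
      if n < 2 then 0 else coeff n (dyadicSeries q) := by
    rw [map_sub, PowerSeries.coeff_C_mul, PowerSeries.coeff_X]
    rcases n with _ | _ | n
    · simp [coeff_zero_dyadicSeries]
    · simp [e]
    · simp
  have hle := seriesSum_mul_le_pow_mul (f := dyadicSeries q - C e * X) (k := 2)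
    (fun n => by rw [hcoeff]; split_ifs; exacts [le_rfl, coeff_dyadicSeries_nonneg hq n])
    (fun n hn => by rw [hcoeff, if_pos hn]) (htail hs).summableAt (dyadicRadius_pos hq).le
    (t := q ^ 2) ⟨sq_nonneg q, pow_le_one₀ hq.1.le hq.2.le⟩
  rw [hsum (hs.of_le hmem.1.le hmem.2), hsum hs, seriesSum_dyadicRadius hq] at hle
  have hval := profileNum_sq_mul_dyadicRadius hq
  rw [profileNum] at hval
  linarith

theorem profile_dyadicRadius : profile q (dyadicRadius q) = 0 := by
  rw [profile, profileNum_dyadicRadius hq, zero_div]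

theorem strictAntiOn_profile : StrictAntiOn (profile q) (Ioc 0 (dyadicRadius q)) := by
  intro x hx y hy hxy
  have hnum := strictAntiOn_profileNum hq ⟨hx.1.le, hx.2⟩ ⟨hy.1.le, hy.2⟩ hxy
  calc profileNum q y / y < profileNum q x / y := div_lt_div_of_pos_right hnum hy.1
    _ ≤ profileNum q x / x := div_le_div_of_nonneg_left
      (profileNum_pos hq hx.1.le (hxy.trans_le hy.2)).le hx.1 hxy.le

theorem profile_nonneg (hx : x ∈ Ioc 0 (dyadicRadius q)) : 0 ≤ profile q x :=
  profile_dyadicRadius hq ▸ (strictAntiOn_profile hq).antitoneOn hx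
    ⟨dyadicRadius_pos hq, le_rfl⟩ hx.2

/-- The inequality `1 - x / R ≤ x h(x)` gives `h(x) ≥ v` at `x = (v + R⁻¹)⁻¹`. -/
theorem surjOn_profile : SurjOn (profile q) (Ioc 0 (dyadicRadius q)) (Ici 0) := by
  intro v (hv : 0 ≤ v)
  have hR := dyadicRadius_pos hq
  obtain ⟨u, hu⟩ : ∃ u, u = (v + (dyadicRadius q)⁻¹)⁻¹ := ⟨_, rfl⟩
  have hpos : 0 < u := hu ▸ by positivity
  have hle : u ≤ dyadicRadius q := hu ▸ inv_le_of_inv_le₀ hR (by linarith)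
  have hcont : ContinuousOn (profile q) (Icc u (dyadicRadius q)) :=
    ((continuousOn_profileNum hq).mono (Icc_subset_Icc_left hpos.le)).div continuousOn_id
      fun x hx => (hpos.trans_le hx.1).ne'
  have hvu : v ≤ profile q u := by
    rw [profile, le_div_iff₀ hpos]
    refine le_trans (le_of_eq ?_) (one_sub_div_le_profileNum hq ⟨hpos.le, hle⟩)
    rw [hu]
    field_simp
    ring
  obtain ⟨x, hx, rfl⟩ := intermediate_value_Icc' hle hcont
    ⟨(profile_dyadicRadius hq).trans_le hv, hvu⟩
  exact ⟨x, ⟨hpos.trans_le hx.1, hx.2⟩, rfl⟩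

theorem bijOn_profile : BijOn (profile q) (Ioc 0 (dyadicRadius q)) (Ici 0) :=
  ⟨fun _ hx => profile_nonneg hq hx, (strictAntiOn_profile hq).injOn, surjOn_profile hq⟩

theorem hasSum_inv_sub_profile (hx : x ∈ Ioc 0 (dyadicRadius q)) :
    HasSum (fun n => coeff (n + 1) (dyadicSeries q) * x ^ n) (x⁻¹ - profile q x) := by
  have hx0 := hx.1.ne'
  have hs := (summableAt_dyadicRadius hq).of_le hx.1.le hx.2
  have htail := ((hasSum_nat_add_iff' 1).2 hs.hasValueAt).mul_right x⁻¹
  rw [Finset.sum_range_one, coeff_zero_dyadicSeries, zero_mul, sub_zero] at htail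
  rw [show x⁻¹ - profile q x = seriesSum (dyadicSeries q) x * x⁻¹ by
    rw [profile, profileNum]; ring]
  refine htail.congr_fun fun n => ?_
  rw [pow_succ, mul_assoc, mul_assoc, mul_inv_cancel₀ hx0, mul_one]

theorem profile_mul_profile_sub_two (hx : x ∈ Ioc 0 (dyadicRadius q)) :
    profile q (q * x) * (profile q (q ^ 2 * x) - 2) = (q ^ 3)⁻¹ * profile q x ^ 2 := by
  have hsq := profileNum_sq hq hx.1.le ((summableAt_dyadicRadius hq).of_le hx.1.le hx.2)
  have hx0 := hx.1.ne'
  have hq0 := hq.1.ne'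
  rw [profile, profile, profile, div_pow, hsq]
  field_simp

end Profile

section SeriesCoefficients

open scoped PowerSeries
open PowerSeries (coeff)

theorem beta_pos : 0 < beta := Real.rpow_pos_of_pos two_pos _

theorem beta_pow_three : beta ^ 3 = 2⁻¹ := by
  rw [beta, ← Real.rpow_natCast, ← Real.rpow_mul two_pos.le]
  norm_num [Real.rpow_neg_one]

theorem beta_sq_pow_three : (beta ^ 2) ^ 3 = 4⁻¹ := by
  rw [pow_right_comm, beta_pow_three]
  norm_num

theorem beta_sq_mem_Ioo : beta ^ 2 ∈ Ioo (0.629 : ℝ) 0.63 :=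
  ⟨lt_of_pow_lt_pow_left₀ 3 (sq_nonneg _) (by rw [beta_sq_pow_three]; norm_num),
    lt_of_pow_lt_pow_left₀ 3 (by norm_num) (by rw [beta_sq_pow_three]; norm_num)⟩

theorem beta_sq_mem_Ioo_zero_one : beta ^ 2 ∈ Ioo (0 : ℝ) 1 :=
  Ioo_subset_Ioo (by norm_num) (by norm_num) beta_sq_mem_Ioo

theorem beta_zpow_eq {k i : ℤ} {n : ℕ} (h : k + i = n - 3) :
    beta ^ (2 * k + 2 * i) = 4 * (beta ^ 2) ^ n := by
  have hsix : beta ^ (6 : ℤ) = 4⁻¹ := by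
    rw [← beta_sq_pow_three, ← pow_mul]
    norm_cast
  rw [show 2 * k + 2 * i = ((2 * n : ℕ) : ℤ) - 6 by omega, zpow_sub₀ beta_pos.ne', hsix,
    div_inv_eq_mul, mul_comm, zpow_natCast, pow_mul]

/-- The power series of `x ↦ x h(x) = -∑ d_k x^(k + 1)`. -/
noncomputable def shiftedSeries (d : ℤ → ℝ) : ℝ⟦X⟧ := PowerSeries.mk fun m : ℕ => -d (m - 1)

theorem sum_Icc_eq_four_mul_sum_antidiagonal (d : ℤ → ℝ) (n : ℕ) :
    ∑ i ∈ Finset.Icc (-1) (n - 1 + 1 : ℤ),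
        d i * d (n - 1 - i) * (4 - beta ^ (2 * (n - 1 : ℤ) + 2 * i)) =
      4 * ∑ p ∈ Finset.HasAntidiagonal.antidiagonal (n + 1),
        coeff p.1 (shiftedSeries d) * coeff p.2 (shiftedSeries d) *
          (1 - (beta ^ 2) ^ (p.1 + 2 * p.2)) := by
  simp only [shiftedSeries, PowerSeries.coeff_mk]
  rw [← Finset.Nat.sum_antidiagonal_swap, Finset.mul_sum]
  refine Finset.sum_bij' (fun i _ => ((i + 1).toNat, (n - i).toNat)) (fun p _ => (p.1 : ℤ) - 1)
    ?_ ?_ ?_ ?_ ?_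
  · intro i hi
    rw [Finset.mem_Icc] at hi
    rw [Finset.HasAntidiagonal.mem_antidiagonal]
    omega
  · intro p hp
    rw [Finset.HasAntidiagonal.mem_antidiagonal] at hp
    rw [Finset.mem_Icc]
    omega
  · intro i hi
    rw [Finset.mem_Icc] at hi
    dsimp only
    omega
  · intro p hp
    rw [Finset.HasAntidiagonal.mem_antidiagonal] at hp
    ext <;> dsimp only <;> omega
  · intro i hi
    rw [Finset.mem_Icc] at hi
    rw [beta_zpow_eq (n := (n - i).toNat + 2 * (i + 1).toNat) (by omega)]
    simp only [Prod.fst_swap, Prod.snd_swap]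
    rw [show (((i + 1).toNat : ℕ) : ℤ) - 1 = i by omega,
      show (((n - i).toNat : ℕ) : ℤ) - 1 = n - 1 - i by omega]
    ring

theorem isSeriesCoefficients_iff {d : ℤ → ℝ} :
    IsSeriesCoefficients d ↔
      (∀ k, k < -1 → d k = 0) ∧ IsFormalProfile (beta ^ 2) (shiftedSeries d) := by
  have hrelation (n : ℕ) :
      (∑ i ∈ Finset.Icc (-1) (n - 1 + 1 : ℤ),
          d i * d (n - 1 - i) * (4 - beta ^ (2 * (n - 1 : ℤ) + 2 * i)) =
        2 * d (n - 1) * beta ^ (2 * (n - 1 : ℤ))) ↔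
      ∑ p ∈ Finset.HasAntidiagonal.antidiagonal (n + 1),
        coeff p.1 (shiftedSeries d) * coeff p.2 (shiftedSeries d) *
          (1 - (beta ^ 2) ^ (p.1 + 2 * p.2)) =
        -(2 * (beta ^ 2) ^ (n + 2) * coeff n (shiftedSeries d)) := by
    have hpow := beta_zpow_eq (k := n - 1) (i := 0) (n := n + 2) (by push_cast; ring)
    rw [mul_zero, add_zero] at hpow
    rw [sum_Icc_eq_four_mul_sum_antidiagonal, hpow, shiftedSeries, PowerSeries.coeff_mk]
    constructor <;> intro h <;> linarith
  have hzero : coeff 0 (shiftedSeries d) = 1 ↔ d (-1) = -1 := by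
    rw [shiftedSeries, PowerSeries.coeff_mk, neg_eq_iff_eq_neg]
    simp only [Nat.cast_zero, zero_sub]
  rw [isFormalProfile_iff_sum_antidiagonal, hzero]
  refine ⟨fun h => ⟨h.eq_zero, h.neg_one, fun n => (hrelation n).1 (h.relation _ (by omega))⟩,
    fun h => ⟨h.1, h.2.1, fun k hk => ?_⟩⟩
  obtain ⟨n, hn⟩ := Int.eq_ofNat_of_zero_le (show 0 ≤ k + 1 by omega)
  obtain rfl : k = n - 1 := by omega
  exact (hrelation n).2 (h.2.2 n)

theorem IsSeriesCoefficients.unique {d d' : ℤ → ℝ} (hd : IsSeriesCoefficients d)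
    (hd' : IsSeriesCoefficients d') : d = d' := by
  rw [isSeriesCoefficients_iff] at hd hd'
  have hseries := hd.2.unique beta_sq_mem_Ioo_zero_one hd'.2
  funext k
  rcases lt_or_ge k (-1) with hk | hk
  · rw [hd.1 k hk, hd'.1 k hk]
  · obtain ⟨n, hn⟩ := Int.eq_ofNat_of_zero_le (show 0 ≤ k + 1 by omega)
    obtain rfl : k = n - 1 := by omega
    have hcoeff := congrArg (coeff n) hseries
    simpa only [shiftedSeries, PowerSeries.coeff_mk, neg_inj] using hcoeff

/-- The sequence `(d_k)` of the theorem. -/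
noncomputable def seriesCoeff (k : ℤ) : ℝ :=
  if k < -1 then 0 else -coeff (k + 1).toNat (1 - dyadicSeries (beta ^ 2))

theorem shiftedSeries_seriesCoeff : shiftedSeries seriesCoeff = 1 - dyadicSeries (beta ^ 2) := by
  ext m
  rw [shiftedSeries, PowerSeries.coeff_mk, seriesCoeff, if_neg (by omega), neg_neg,
    sub_add_cancel, Int.toNat_natCast]

theorem isSeriesCoefficients_seriesCoeff : IsSeriesCoefficients seriesCoeff :=
  isSeriesCoefficients_iff.2 ⟨fun _ hk => if_pos hk, shiftedSeries_seriesCoeff ▸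
    isFormalProfile_one_sub_dyadicSeries beta_sq_mem_Ioo_zero_one⟩

theorem seriesCoeff_natCast (k : ℕ) :
    seriesCoeff k = coeff (k + 1) (dyadicSeries (beta ^ 2)) := by
  rw [seriesCoeff, if_neg (by omega), ← Nat.cast_succ, Int.toNat_natCast,
    coeff_one_sub_dyadicSeries k.succ_ne_zero, neg_neg]

theorem seriesCoeff_nonneg {k : ℤ} (hk : 0 ≤ k) : 0 ≤ seriesCoeff k := by
  lift k to ℕ using hk
  rw [seriesCoeff_natCast]
  exact coeff_dyadicSeries_nonneg beta_sq_mem_Ioo_zero_one _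

theorem convergenceRadius_seriesCoeff :
    convergenceRadius (fun k : ℕ => seriesCoeff k) =
      ENNReal.ofReal (dyadicRadius (beta ^ 2)) := by
  simp only [seriesCoeff_natCast]
  exact convergenceRadius_dyadicSeries beta_sq_mem_Ioo_zero_one

theorem hasSum_seriesCoeff {x : ℝ} (hx : x ∈ Ioc 0 (dyadicRadius (beta ^ 2))) :
    HasSum (fun k : ℕ => seriesCoeff k * x ^ k) (x⁻¹ - profile (beta ^ 2) x) := by
  simp only [seriesCoeff_natCast]
  exact hasSum_inv_sub_profile beta_sq_mem_Ioo_zero_one hx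

theorem coeff_one_dyadicSeries_beta_sq_mem_Ioo :
    coeff 1 (dyadicSeries (beta ^ 2)) ∈ Ioo (4 / 5 : ℝ) 1 := by
  have hcoeff := coeff_one_dyadicSeries_mul beta_sq_mem_Ioo_zero_one
  have hpos := two_sub_pow_sub_pow_pos beta_sq_mem_Ioo_zero_one 0
  obtain ⟨hl, hu⟩ := beta_sq_mem_Ioo
  set q := beta ^ 2
  rw [zero_add, mul_one, pow_one] at hpos
  constructor
  · refine lt_of_mul_lt_mul_right ?_ hpos.le
    nlinarith
  · refine lt_of_mul_lt_mul_right ?_ hpos.le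
    nlinarith

theorem dyadicRadius_beta_sq_mem_Ioo : dyadicRadius (beta ^ 2) ∈ Ioo (4 / 5 : ℝ) 1 := by
  have hupper := dyadicRadius_mul_le_one beta_sq_mem_Ioo_zero_one
  have hlower := one_sub_pow_four_le_dyadicRadius_mul beta_sq_mem_Ioo_zero_one
  have hR := dyadicRadius_pos beta_sq_mem_Ioo_zero_one
  obtain ⟨hl, hu⟩ := beta_sq_mem_Ioo
  obtain ⟨hel, heu⟩ := coeff_one_dyadicSeries_beta_sq_mem_Ioo
  set q := beta ^ 2
  set e := coeff 1 (dyadicSeries q)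
  have hq2l : 0.395 < q ^ 2 := by nlinarith
  have hq2u : q ^ 2 < 0.397 := by nlinarith
  constructor
  · have hfour : q ^ 4 < 0.158 := by nlinarith
    have hdenom : 2 * q ^ 2 + e * (q ^ 2 - q ^ 4) < 1.04 := by nlinarith
    nlinarith
  · have hfactor : 1 < q ^ 2 * (2 + e) := by nlinarith
    nlinarith

end SeriesCoefficients

/-- The recurrence `b_{n+2} = 2 + κ b_n² / b_{n+1}` with `b_0 = 0 < b_1`, which for `κ = 4` is that
of the rescaled coefficients `ã_n`. -/
structure IsRescaledSequence (κ : ℝ) (b : ℕ → ℝ) : Prop where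
  zero : b 0 = 0
  one_pos : 0 < b 1
  recurrence : ∀ n, b (n + 2) = 2 + κ * b n ^ 2 / b (n + 1)

namespace IsRescaledSequence

variable {κ : ℝ} {b s : ℕ → ℝ}

theorem two (hb : IsRescaledSequence κ b) : b 2 = 2 := by
  rw [hb.recurrence 0, hb.zero, zero_pow two_ne_zero, mul_zero, zero_div, add_zero]

theorem unique (hb : IsRescaledSequence κ b) (hs : IsRescaledSequence κ s) (h : b 1 = s 1) :
    b = s := by
  have hpair (n : ℕ) : b n = s n ∧ b (n + 1) = s (n + 1) := by
    induction n with
    | zero => exact ⟨hb.zero.trans hs.zero.symm, h⟩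
    | succ n ih => exact ⟨ih.2, by rw [hb.recurrence, hs.recurrence, ih.1, ih.2]⟩
  exact funext fun n => (hpair n).1

variable (hκ : 0 < κ)
include hκ

theorem pos (hb : IsRescaledSequence κ b) (n : ℕ) : 0 < b (n + 1) := by
  induction n with
  | zero => exact hb.one_pos
  | succ n ih =>
    rw [hb.recurrence n]
    positivity

theorem lt_step (hb : IsRescaledSequence κ b) (hs : IsRescaledSequence κ s) {n : ℕ}
    (hlt : s (n + 1) < b (n + 1)) (hle : b (n + 2) ≤ s (n + 2)) : s (n + 3) < b (n + 3) := by
  have := hs.pos hκ n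
  have := hb.pos hκ (n + 1)
  rw [hb.recurrence (n + 1), hs.recurrence (n + 1)]
  gcongr

theorem le_step (hb : IsRescaledSequence κ b) (hs : IsRescaledSequence κ s) {n : ℕ}
    (hle : b (n + 1) ≤ s (n + 1)) (hlt : s (n + 2) < b (n + 2)) : b (n + 3) ≤ s (n + 3) := by
  have := hb.pos hκ n
  have := hs.pos hκ (n + 1)
  rw [hb.recurrence (n + 1), hs.recurrence (n + 1)]
  gcongr

/-- The first index at which `b` exceeds `s` is `1` if `s 1 < b 1` and `4` otherwise. -/
theorem exists_lt_and_succ_le (hb : IsRescaledSequence κ b) (hs : IsRescaledSequence κ s)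
    (h : b 1 ≠ s 1) : ∃ N, s (N + 1) < b (N + 1) ∧ b (N + 2) ≤ s (N + 2) := by
  have htwo : b 2 = s 2 := hb.two.trans hs.two.symm
  rcases h.lt_or_gt with hone | hone
  · have hb₁ := hb.pos hκ 0
    have hs₂ := hs.pos hκ 1
    have hthree : b 3 < s 3 := by
      rw [hb.recurrence 1, hs.recurrence 1, htwo]
      gcongr
    have hfour : s 4 < b 4 := by
      have hb₃ := hb.pos hκ 2
      rw [hb.recurrence 2, hs.recurrence 2, htwo]
      gcongr
    exact ⟨3, hfour, hb.le_step hκ hs (n := 2) hthree.le hfour⟩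
  · exact ⟨0, hone, htwo.le⟩

theorem alternation (hb : IsRescaledSequence κ b) (hs : IsRescaledSequence κ s) {N : ℕ}
    (hlt : s (N + 1) < b (N + 1)) (hle : b (N + 2) ≤ s (N + 2)) (j : ℕ) :
    s (N + 2 * j + 1) < b (N + 2 * j + 1) ∧ b (N + 2 * j + 2) ≤ s (N + 2 * j + 2) := by
  induction j with
  | zero => exact ⟨hlt, hle⟩
  | succ j ih =>
    have hlt' := hb.lt_step hκ hs ih.1 ih.2
    exact ⟨hlt', hb.le_step hκ hs (n := N + 2 * j + 1) ih.2 hlt'⟩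

theorem mul_ratio_sq_sub_one_le (hb : IsRescaledSequence κ b) (hs : IsRescaledSequence κ s) {n : ℕ}
    (h : b (n + 2) ≤ s (n + 2)) :
    (1 - 2 / s (n + 3)) * ((b (n + 1) / s (n + 1)) ^ 2 - 1) ≤ b (n + 3) / s (n + 3) - 1 := by
  have hs₁ := hs.pos hκ n
  have hs₂ := hs.pos hκ (n + 1)
  have hs₃ := hs.pos hκ (n + 2)
  have hb₂ := hb.pos hκ (n + 1)
  have hsquare : (b (n + 1) / s (n + 1)) ^ 2 * (s (n + 3) - 2) ≤ b (n + 3) - 2 := by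
    rw [hb.recurrence (n + 1), hs.recurrence (n + 1), add_sub_cancel_left, add_sub_cancel_left]
    calc (b (n + 1) / s (n + 1)) ^ 2 * (κ * s (n + 1) ^ 2 / s (n + 2))
        = κ * b (n + 1) ^ 2 / s (n + 2) := by field_simp
      _ ≤ κ * b (n + 1) ^ 2 / b (n + 2) := div_le_div_of_nonneg_left (by positivity) hb₂ h
  calc (1 - 2 / s (n + 3)) * ((b (n + 1) / s (n + 1)) ^ 2 - 1)
      = ((b (n + 1) / s (n + 1)) ^ 2 * (s (n + 3) - 2) + 2) / s (n + 3) - 1 := by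
        field_simp
        ring
    _ ≤ b (n + 3) / s (n + 3) - 1 := by
        gcongr
        linarith

/-- Along the indices where `b` exceeds `s`, the quantity `b / s - 1` eventually grows by the factor
`3 / 2 = (1 - 2 / 8) * 2` in each step of length two. -/
theorem tendsto_ratio (hb : IsRescaledSequence κ b) (hs : IsRescaledSequence κ s)
    (hlim : Tendsto s atTop atTop) {N : ℕ} (hlt : s (N + 1) < b (N + 1))
    (hle : b (N + 2) ≤ s (N + 2)) :
    Tendsto (fun j => b (N + 2 * j + 1) / s (N + 2 * j + 1)) atTop atTop := by
  have halt := hb.alternation hκ hs hlt hle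
  have hpos (j : ℕ) : 0 < b (N + 2 * j + 1) / s (N + 2 * j + 1) - 1 :=
    sub_pos.2 ((one_lt_div (hs.pos hκ _)).2 (halt j).1)
  obtain ⟨J, hJ⟩ := eventually_atTop.1 (hlim.eventually_ge_atTop 8)
  have hgeom : Tendsto
      (fun j => b (N + 2 * (j + J) + 1) / s (N + 2 * (j + J) + 1) - 1) atTop atTop := by
    refine tendsto_atTop_of_geom_le (c := 3 / 2) (hpos _) (by norm_num) fun j => ?_
    have hratio := hb.mul_ratio_sq_sub_one_le hκ hs (halt (j + J)).2
    have hsmall : 2 / s (N + 2 * (j + J) + 3) ≤ 1 / 4 := by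
      rw [div_le_iff₀ (hs.pos hκ _)]
      linarith [hJ (N + 2 * (j + J) + 3) (by omega)]
    rw [show N + 2 * (j + 1 + J) + 1 = N + 2 * (j + J) + 3 by ring]
    refine le_trans ?_ hratio
    nlinarith [hpos (j + J), mul_pos (hpos (j + J)) (hpos (j + J))]
  have hsub := (tendsto_add_atTop_iff_nat
    (f := fun j => b (N + 2 * j + 1) / s (N + 2 * j + 1) - 1) J).1 hgeom
  simpa only [sub_add_cancel] using tendsto_atTop_add_const_right atTop 1 hsub

theorem eventually_mul_le_add_two (hb : IsRescaledSequence κ b) (hs : IsRescaledSequence κ s)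
    (hlim : Tendsto s atTop atTop) {C : ℝ} (hC : ∀ᶠ n in atTop, s (n + 1) ≤ C * s n) {N : ℕ}
    (hlt : s (N + 1) < b (N + 1)) (hle : b (N + 2) ≤ s (N + 2)) {K : ℝ} (hK : 0 < K) :
    ∀ᶠ j in atTop, K * b (N + 2 * j + 1) ≤ b (N + 2 * j + 1 + 2) := by
  obtain ⟨J, hJ⟩ := eventually_atTop.1 hC
  filter_upwards [(hb.tendsto_ratio hκ hs hlim hlt hle).eventually_ge_atTop (K * C / κ),
    eventually_ge_atTop J] with j hratio hj
  have hpos := hb.pos hκ (N + 2 * j)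
  have hpos' := hb.pos hκ (N + 2 * j + 1)
  have hnext : K * b (N + 2 * j + 1 + 1) ≤ κ * b (N + 2 * j + 1) := by
    rw [div_le_div_iff₀ hκ (hs.pos hκ _)] at hratio
    calc K * b (N + 2 * j + 1 + 1) ≤ K * s (N + 2 * j + 1 + 1) :=
          mul_le_mul_of_nonneg_left (hb.alternation hκ hs hlt hle j).2 hK.le
      _ ≤ K * (C * s (N + 2 * j + 1)) := mul_le_mul_of_nonneg_left (hJ _ (by omega)) hK.le
      _ ≤ κ * b (N + 2 * j + 1) := by linarith
  calc K * b (N + 2 * j + 1) ≤ κ * b (N + 2 * j + 1) ^ 2 / b (N + 2 * j + 1 + 1) := by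
        rw [le_div_iff₀ hpos']
        nlinarith
    _ ≤ b (N + 2 * j + 1 + 2) := by
        rw [hb.recurrence (N + 2 * j + 1)]
        linarith

end IsRescaledSequence

/-- The solution `n ↦ h(q^n R)` of the rescaled recurrence, which separates the two behaviours. -/
noncomputable def profileSeq (q : ℝ) (n : ℕ) : ℝ := profile q (q ^ n * dyadicRadius q)

section ProfileSeq

variable {q : ℝ} (hq : q ∈ Ioo (0 : ℝ) 1)
include hq

theorem profileSeq_succ_pos (n : ℕ) : 0 < profileSeq q (n + 1) :=
  have hmem := pow_mul_dyadicRadius_mem hq (n + 1)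
  div_pos (profileNum_pos hq hmem.1.le (mul_lt_of_lt_one_left (dyadicRadius_pos hq)
    (pow_lt_one₀ hq.1.le hq.2 n.succ_ne_zero))) hmem.1

theorem isRescaledSequence_profileSeq : IsRescaledSequence (q ^ 3)⁻¹ (profileSeq q) where
  zero := by rw [profileSeq, pow_zero, one_mul, profile_dyadicRadius hq]
  one_pos := profileSeq_succ_pos hq 0
  recurrence n := by
    have hmul := profile_mul_profile_sub_two hq (pow_mul_dyadicRadius_mem hq n)
    rw [← mul_assoc, ← mul_assoc, ← pow_succ', ← pow_add, add_comm 2] at hmul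
    exact eq_add_of_sub_eq' <|
      (eq_div_iff_mul_eq (profileSeq_succ_pos hq n).ne').2 ((mul_comm _ _).trans hmul)

theorem tendsto_profileSeq : Tendsto (profileSeq q) atTop atTop := by
  have hzero : Tendsto (fun n => q ^ n * dyadicRadius q) atTop (𝓝[>] 0) := by
    refine tendsto_nhdsWithin_iff.2
      ⟨?_, Eventually.of_forall fun n => (pow_mul_dyadicRadius_mem hq n).1⟩
    simpa only [zero_mul] using
      (tendsto_pow_atTop_nhds_zero_of_lt_one hq.1.le hq.2).mul_const (dyadicRadius q)
  exact (tendsto_profileNum_pow_mul hq).pos_mul_atTop one_pos hzero.inv_tendsto_nhdsGT_zero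

theorem eventually_profileSeq_succ_le :
    ∀ᶠ n in atTop, profileSeq q (n + 1) ≤ 2 / q * profileSeq q n := by
  filter_upwards [(tendsto_profileNum_pow_mul hq).eventually_const_le
    (u := 2⁻¹) (by norm_num)] with n hn
  have hmem := pow_mul_dyadicRadius_mem hq n
  have hq0 := hq.1.ne'
  calc profileSeq q (n + 1) ≤ 1 / (q ^ (n + 1) * dyadicRadius q) :=
        div_le_div_of_nonneg_right (profileNum_le_one hq (pow_mul_dyadicRadius_mem hq _).1.le)
          (pow_mul_dyadicRadius_mem hq _).1.le
    _ = 2 / q * (2⁻¹ / (q ^ n * dyadicRadius q)) := by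
        rw [pow_succ]
        field_simp
    _ ≤ 2 / q * profileSeq q n :=
        mul_le_mul_of_nonneg_left (div_le_div_of_nonneg_right hn hmem.1.le)
          (div_nonneg zero_le_two hq.1.le)

end ProfileSeq

section SuperExponentialDivergence

theorem tendsto_div_pow_of_eventually_mul_le {u : ℕ → ℝ} (hpos : ∀ j, 0 < u j)
    (h : ∀ K : ℝ, 0 < K → ∀ᶠ j in atTop, K * u j ≤ u (j + 1)) {M : ℝ} (hM : 0 < M) :
    Tendsto (fun j => u j / M ^ j) atTop atTop := by
  obtain ⟨J, hJ⟩ := eventually_atTop.1 (h (2 * M) (mul_pos two_pos hM))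
  refine (tendsto_add_atTop_iff_nat J).1
    (tendsto_atTop_of_geom_le (c := 2) (div_pos (hpos _) (pow_pos hM _)) one_lt_two fun j => ?_)
  have hstep := hJ (j + J) (by omega)
  have hpow := pow_pos hM (j + J)
  rw [show j + 1 + J = j + J + 1 by ring, pow_succ, ← mul_div_assoc,
    div_le_div_iff₀ hpow (mul_pos hpow hM)]
  nlinarith

variable {a : ℕ → ℝ}

theorem divergesSuperExponentially_of_eventually_mul_le {L : ℕ} (hpos : ∀ j, 0 < a (2 * j + L))
    (h : ∀ K : ℝ, 0 < K → ∀ᶠ j in atTop, K * a (2 * j + L) ≤ a (2 * (j + 1) + L)) :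
    DivergesSuperExponentially a := by
  refine ⟨L % 2, by omega, fun M hM => (tendsto_add_atTop_iff_nat (L / 2)).1 ?_⟩
  refine ((tendsto_div_pow_of_eventually_mul_le hpos h hM).atTop_div_const
    (pow_pos hM (L / 2))).congr fun j => ?_
  rw [div_div, ← pow_add, show 2 * (j + L / 2) + L % 2 = 2 * j + L by omega]

theorem tendsto_two_mul_add_atTop (p : ℕ) : Tendsto (fun k : ℕ => 2 * k + p) atTop atTop :=
  tendsto_atTop_mono (fun k => by dsimp only [id]; omega) tendsto_id

theorem DivergesSuperExponentially.not_squareSummable (h : DivergesSuperExponentially a) :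
    ¬ SquareSummable a := by
  intro hs
  obtain ⟨p, -, hp⟩ := h
  have hlim := hp 1 one_pos
  simp only [one_pow, div_one] at hlim
  exact not_tendsto_nhds_of_tendsto_atTop ((tendsto_pow_atTop two_ne_zero).comp hlim) 0
    (hs.tendsto_atTop_zero.comp (tendsto_two_mul_add_atTop p))

theorem DivergesSuperExponentially.convergenceRadius_eq_zero (h : DivergesSuperExponentially a) :
    convergenceRadius a = 0 := by
  by_contra hne
  obtain ⟨r, hr0, hr⟩ := ENNReal.lt_iff_exists_nnreal_btwn.1 (pos_iff_ne_zero.2 hne)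
  have hrpos : (0 : ℝ) < r := by exact_mod_cast hr0
  have hs := FormalMultilinearSeries.summable_norm_mul_pow _ hr
  simp only [FormalMultilinearSeries.ofScalars_norm] at hs
  obtain ⟨p, -, hp⟩ := h
  have hlim := (hp (((r : ℝ) ^ 2)⁻¹) (by positivity)).atTop_mul_const (pow_pos hrpos p)
  refine not_tendsto_nhds_of_tendsto_atTop (tendsto_atTop_mono (fun k => ?_) hlim) 0
    (hs.tendsto_atTop_zero.comp (tendsto_two_mul_add_atTop p))
  rw [inv_pow, div_inv_eq_mul, mul_assoc, ← pow_mul, ← pow_add]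
  exact mul_le_mul_of_nonneg_right (le_abs_self _) (by positivity)

end SuperExponentialDivergence

section CoefficientSequences

variable {n₀ n : ℕ} {a a' : ℕ → ℝ}

theorem eq_inv_two_pow_mul_rescaled (hn : n₀ ≤ n) (a : ℕ → ℝ) :
    a n = (2 ^ n)⁻¹ * rescaled n₀ a (n - n₀) := by
  rw [rescaled, Nat.sub_add_cancel hn, inv_mul_cancel_left₀ (by positivity)]

/-- If `a (n + n₀ + 1) = 0`, both quotients have the junk value `0`. -/
theorem rescaled_add_two_eq_iff :
    rescaled n₀ a (n + 2) = 2 + 4 * rescaled n₀ a n ^ 2 / rescaled n₀ a (n + 1) ↔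
      a (n + n₀ + 2) = (2 ^ (n + n₀ + 1))⁻¹ + a (n + n₀) ^ 2 / (2 * a (n + n₀ + 1)) := by
  have hpow : (2 : ℝ) ^ (n + n₀) ≠ 0 := by positivity
  have hscale : 2 + 4 * rescaled n₀ a n ^ 2 / rescaled n₀ a (n + 1) =
      2 ^ (n + n₀ + 2) *
        ((2 ^ (n + n₀ + 1))⁻¹ + a (n + n₀) ^ 2 / (2 * a (n + n₀ + 1))) := by
    rw [rescaled, rescaled, Nat.add_right_comm n 1, pow_succ, pow_succ, pow_succ, mul_add, mul_pow]
    field_simp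
    ring
  rw [hscale, rescaled, Nat.add_right_comm n 2]
  exact mul_right_inj' (by positivity)

theorem isCoefficientSequence_iff_isRescaledSequence :
    IsCoefficientSequence n₀ a ↔
      (∀ n < n₀, a n = 0) ∧ IsRescaledSequence 4 (rescaled n₀ a) := by
  have hzero : rescaled n₀ a 0 = 0 ↔ a n₀ = 0 := by
    rw [rescaled, zero_add, mul_eq_zero_iff_left (by positivity)]
  have hone : 0 < rescaled n₀ a 1 ↔ 0 < a (n₀ + 1) := by
    rw [rescaled, add_comm 1, mul_pos_iff_of_pos_left (by positivity)]
  constructor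
  · intro ha
    refine ⟨fun n hn => ha.eq_zero n hn.le, hzero.2 (ha.eq_zero n₀ le_rfl), hone.2 ha.pos,
      fun n => rescaled_add_two_eq_iff.2 ?_⟩
    exact ha.recurrence (n + n₀ + 1) (by omega)
  · rintro ⟨ha, hb⟩
    refine ⟨fun n hn => hn.lt_or_eq.elim (ha n) fun h => h ▸ hzero.1 hb.zero, hone.1 hb.one_pos,
      fun n hn => ?_⟩
    obtain ⟨k, rfl⟩ := Nat.exists_eq_add_of_le' hn
    exact rescaled_add_two_eq_iff.1 (hb.recurrence k)

namespace IsCoefficientSequence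

theorem isRescaledSequence (ha : IsCoefficientSequence n₀ a) :
    IsRescaledSequence 4 (rescaled n₀ a) :=
  (isCoefficientSequence_iff_isRescaledSequence.1 ha).2

theorem pos_of_lt (ha : IsCoefficientSequence n₀ a) (hn : n₀ < n) : 0 < a n := by
  obtain ⟨k, rfl⟩ := Nat.exists_eq_add_of_le' (Nat.succ_le_of_lt hn)
  rw [eq_inv_two_pow_mul_rescaled hn.le a, show k + n₀.succ - n₀ = k + 1 by omega]
  exact mul_pos (by positivity) (ha.isRescaledSequence.pos four_pos k)

theorem nonneg (ha : IsCoefficientSequence n₀ a) (n : ℕ) : 0 ≤ a n :=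
  (lt_or_ge n₀ n).elim (fun h => (ha.pos_of_lt h).le) fun h => (ha.eq_zero n h).ge

theorem unique (ha : IsCoefficientSequence n₀ a) (ha' : IsCoefficientSequence n₀ a')
    (h : rescaled n₀ a 1 = rescaled n₀ a' 1) : a = a' := by
  funext n
  rcases le_or_gt n₀ n with hn | hn
  · rw [eq_inv_two_pow_mul_rescaled hn a, eq_inv_two_pow_mul_rescaled hn a',
      ha.isRescaledSequence.unique ha'.isRescaledSequence h]
  · rw [ha.eq_zero n hn.le, ha'.eq_zero n hn.le]

end IsCoefficientSequence

theorem isRescaledSequence_profileSeq_beta_sq : IsRescaledSequence 4 (profileSeq (beta ^ 2)) := by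
  simpa only [beta_sq_pow_three, inv_inv] using
    isRescaledSequence_profileSeq beta_sq_mem_Ioo_zero_one

theorem IsCoefficientSequence.divergesSuperExponentially (ha : IsCoefficientSequence n₀ a)
    (h : rescaled n₀ a 1 ≠ profileSeq (beta ^ 2) 1) : DivergesSuperExponentially a := by
  have hb := ha.isRescaledSequence
  have hs := isRescaledSequence_profileSeq_beta_sq
  obtain ⟨N, hlt, hle⟩ := hb.exists_lt_and_succ_le four_pos hs h
  refine divergesSuperExponentially_of_eventually_mul_le (L := N + 1 + n₀)
    (fun j => ha.pos_of_lt (by omega)) fun K hK => ?_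
  filter_upwards [hb.eventually_mul_le_add_two four_pos hs
    (tendsto_profileSeq beta_sq_mem_Ioo_zero_one)
    (eventually_profileSeq_succ_le beta_sq_mem_Ioo_zero_one) hlt hle
    (mul_pos four_pos hK)] with j hj
  rw [rescaled, rescaled, show N + 2 * j + 1 + 2 + n₀ = 2 * (j + 1) + (N + 1 + n₀) by ring,
    show N + 2 * j + 1 + n₀ = 2 * j + (N + 1 + n₀) by ring] at hj
  have hpow : (2 : ℝ) ^ (2 * (j + 1) + (N + 1 + n₀)) = 4 * 2 ^ (2 * j + (N + 1 + n₀)) := by ring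
  rw [hpow] at hj
  refine le_of_mul_le_mul_left (a := 4 * (2 : ℝ) ^ (2 * j + (N + 1 + n₀))) ?_ (by positivity)
  linarith

/-- The coefficients `a_n` of the self-similar solution of finite energy. -/
noncomputable def finiteEnergyCoeff (n₀ n : ℕ) : ℝ :=
  if n < n₀ then 0 else (2 ^ n)⁻¹ * profileSeq (beta ^ 2) (n - n₀)

theorem finiteEnergyCoeff_of_le (h : n₀ ≤ n) :
    finiteEnergyCoeff n₀ n = (2 ^ n)⁻¹ * profile (beta ^ 2)
      (beta ^ (2 * (n - n₀)) * dyadicRadius (beta ^ 2)) := by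
  rw [finiteEnergyCoeff, if_neg h.not_gt, profileSeq, pow_mul]

theorem rescaled_finiteEnergyCoeff (n₀ : ℕ) :
    rescaled n₀ (finiteEnergyCoeff n₀) = profileSeq (beta ^ 2) := by
  funext n
  rw [rescaled, finiteEnergyCoeff, if_neg (by omega), Nat.add_sub_cancel,
    mul_inv_cancel_left₀ (by positivity)]

theorem isCoefficientSequence_finiteEnergyCoeff (n₀ : ℕ) :
    IsCoefficientSequence n₀ (finiteEnergyCoeff n₀) :=
  isCoefficientSequence_iff_isRescaledSequence.2 ⟨fun _ hn => if_pos hn,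
    rescaled_finiteEnergyCoeff n₀ ▸ isRescaledSequence_profileSeq_beta_sq⟩

theorem finiteEnergyCoeff_eq_profileNum_mul (h : n₀ ≤ n) :
    finiteEnergyCoeff n₀ n =
      profileNum (beta ^ 2) ((beta ^ 2) ^ (n - n₀) * dyadicRadius (beta ^ 2)) *
        (beta ^ (2 * n₀) / dyadicRadius (beta ^ 2) * beta ^ n) := by
  obtain ⟨k, rfl⟩ := Nat.exists_eq_add_of_le h
  have hbeta := beta_pos.ne'
  have hR := (dyadicRadius_pos beta_sq_mem_Ioo_zero_one).ne'
  rw [finiteEnergyCoeff, if_neg h.not_gt, Nat.add_sub_cancel_left, profileSeq, profile,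
    ← inv_pow, ← beta_pow_three]
  field_simp
  ring

theorem isEquivalent_finiteEnergyCoeff (n₀ : ℕ) :
    finiteEnergyCoeff n₀ ~[atTop]
      fun n => beta ^ (2 * n₀) / dyadicRadius (beta ^ 2) * beta ^ n :=
  isEquivalent_iff_exists_eq_mul.2 ⟨_,
    (tendsto_profileNum_pow_mul beta_sq_mem_Ioo_zero_one).comp (tendsto_sub_atTop_nat n₀),
    (eventually_ge_atTop n₀).mono fun _ hn => finiteEnergyCoeff_eq_profileNum_mul hn⟩

theorem waveNumber_rpow (n : ℕ) : waveNumber n ^ (-(1 / 3) : ℝ) = beta ^ n := by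
  rw [waveNumber, beta, Real.rpow_pow_comm two_pos.le]

theorem tendsto_finiteEnergyCoeff_div (n₀ : ℕ) :
    Tendsto (fun n => finiteEnergyCoeff n₀ n / waveNumber n ^ (-(1 / 3) : ℝ)) atTop
      (𝓝 (beta ^ (2 * n₀) / dyadicRadius (beta ^ 2))) := by
  have hbeta (n : ℕ) : beta ^ n ≠ 0 := pow_ne_zero n beta_pos.ne'
  have hequiv := (isEquivalent_finiteEnergyCoeff n₀).div
    (IsEquivalent.refl (u := fun n => beta ^ n))
  simp only [waveNumber_rpow]
  refine (hequiv.congr_right (Eventually.of_forall fun n => ?_)).tendsto_const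
  exact mul_div_cancel_right₀ _ (hbeta n)

theorem squareSummable_finiteEnergyCoeff (n₀ : ℕ) : SquareSummable (finiteEnergyCoeff n₀) := by
  have hgeom : Summable fun n =>
      (beta ^ (2 * n₀) / dyadicRadius (beta ^ 2) * beta ^ n) ^ 2 :=
    ((summable_geometric_of_lt_one (sq_nonneg beta) beta_sq_mem_Ioo_zero_one.2).mul_left
      ((beta ^ (2 * n₀) / dyadicRadius (beta ^ 2)) ^ 2)).congr fun n => by
        rw [mul_pow, pow_right_comm beta n 2]
  exact summable_of_isBigO_nat hgeom ((isEquivalent_finiteEnergyCoeff n₀).isBigO.pow 2)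

theorem IsCoefficientSequence.squareSummable_iff_rescaled_eq (ha : IsCoefficientSequence n₀ a) :
    SquareSummable a ↔ rescaled n₀ a 1 = profileSeq (beta ^ 2) 1 := by
  refine ⟨fun hs => ?_, fun h => ?_⟩
  · by_contra hne
    exact (ha.divergesSuperExponentially hne).not_squareSummable hs
  · rw [ha.unique (isCoefficientSequence_finiteEnergyCoeff n₀)
      (by rw [h, rescaled_finiteEnergyCoeff])]
    exact squareSummable_finiteEnergyCoeff n₀

theorem IsCoefficientSequence.squareSummable_iff_eq (ha : IsCoefficientSequence n₀ a) :
    SquareSummable a ↔ a = finiteEnergyCoeff n₀ := by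
  rw [ha.squareSummable_iff_rescaled_eq, ← rescaled_finiteEnergyCoeff n₀]
  exact ⟨ha.unique (isCoefficientSequence_finiteEnergyCoeff n₀), fun h => by rw [h]⟩

theorem forall_squareSummable_iff_rescaled_eq_iff {n₀ : ℕ} {c : ℝ} :
    (∀ a, IsCoefficientSequence n₀ a → (SquareSummable a ↔ rescaled n₀ a 1 = c)) ↔
      c = profile (beta ^ 2) (beta ^ 2 * dyadicRadius (beta ^ 2)) := by
  have hone : profile (beta ^ 2) (beta ^ 2 * dyadicRadius (beta ^ 2)) =
      profileSeq (beta ^ 2) 1 := by rw [profileSeq, pow_one]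
  rw [hone]
  refine ⟨fun h => ?_, fun hc a ha => hc ▸ ha.squareSummable_iff_rescaled_eq⟩
  rw [← rescaled_finiteEnergyCoeff n₀]
  exact ((h _ (isCoefficientSequence_finiteEnergyCoeff n₀)).1
    (squareSummable_finiteEnergyCoeff n₀)).symm

end CoefficientSequences

section SelfSimilarSolutions

variable {a : ℕ → ℝ} {t₀ t : ℝ} {I : Set ℝ} {n₀ n : ℕ}

/-- The equations to which the dyadic system reduces for `X_n(t) = a_n / (t - t₀)`: both sides of
the `n`-th equation are multiples of `(t - t₀)⁻²`. The index is shifted to avoid subtraction. -/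
structure IsSelfSimilarCoefficients (a : ℕ → ℝ) : Prop where
  zero : a 0 = 0
  neg_succ : ∀ n, -a (n + 1) = 2 ^ n * a n ^ 2 - 2 ^ (n + 1) * a (n + 1) * a (n + 2)

theorem hasDerivAt_selfSimilar (a : ℕ → ℝ) (n : ℕ) (ht : t ≠ t₀) :
    HasDerivAt (selfSimilar t₀ a n) (-a n / (t - t₀) ^ 2) t := by
  simpa only [zero_mul, mul_one, zero_sub, id] using!
    (hasDerivAt_const t (a n)).fun_div ((hasDerivAt_id t).sub_const t₀) (sub_ne_zero.2 ht)

theorem neg_div_sq_eq_selfSimilar_iff (ht : t ≠ t₀) :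
    -a (n + 1) / (t - t₀) ^ 2 = waveNumber n * selfSimilar t₀ a n t ^ 2 -
        waveNumber (n + 1) * selfSimilar t₀ a (n + 1) t * selfSimilar t₀ a (n + 2) t ↔
      -a (n + 1) = 2 ^ n * a n ^ 2 - 2 ^ (n + 1) * a (n + 1) * a (n + 2) := by
  have hne := sub_ne_zero.2 ht
  have hrhs : waveNumber n * selfSimilar t₀ a n t ^ 2 -
      waveNumber (n + 1) * selfSimilar t₀ a (n + 1) t * selfSimilar t₀ a (n + 2) t =
        (2 ^ n * a n ^ 2 - 2 ^ (n + 1) * a (n + 1) * a (n + 2)) / (t - t₀) ^ 2 := by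
    simp only [selfSimilar, waveNumber]
    field_simp
  rw [hrhs, div_left_inj' (pow_ne_zero 2 hne)]

theorem IsSelfSimilarCoefficients.isComponentwiseSolutionOn (ha : IsSelfSimilarCoefficients a)
    (hI : t₀ ∉ I) : IsComponentwiseSolutionOn I (selfSimilar t₀ a) where
  zero t _ := by rw [selfSimilar, ha.zero, zero_div]
  contDiffOn n := contDiffOn_const.div (contDiffOn_id.sub contDiffOn_const)
    fun _ ht => sub_ne_zero.2 (ne_of_mem_of_not_mem ht hI)
  equation n hn t ht := by
    have hne := ne_of_mem_of_not_mem ht hI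
    obtain ⟨m, rfl⟩ := Nat.exists_eq_add_of_le' hn
    rw [Nat.add_sub_cancel, ← (neg_div_sq_eq_selfSimilar_iff hne).2 (ha.neg_succ m)]
    exact (hasDerivAt_selfSimilar a (m + 1) hne).hasDerivWithinAt

theorem isSelfSimilarCoefficients_of_isComponentwiseSolutionOn
    (h : IsComponentwiseSolutionOn I (selfSimilar t₀ a)) (ht : t ∈ I) (hne : t ≠ t₀)
    (hI : UniqueDiffWithinAt ℝ I t) : IsSelfSimilarCoefficients a where
  zero := (div_eq_zero_iff.1 (h.zero t ht)).resolve_right (sub_ne_zero.2 hne)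
  neg_succ n := (neg_div_sq_eq_selfSimilar_iff hne).1 <|
    hI.eq_deriv _ (hasDerivAt_selfSimilar a (n + 1) hne).hasDerivWithinAt
      (h.equation (n + 1) n.succ_pos t ht)

theorem neg_succ_eq_iff_add_two_eq (h : a (n + 1) ≠ 0) :
    -a (n + 1) = 2 ^ n * a n ^ 2 - 2 ^ (n + 1) * a (n + 1) * a (n + 2) ↔
      a (n + 2) = (2 ^ (n + 1))⁻¹ + a n ^ 2 / (2 * a (n + 1)) := by
  have hrhs : (2 ^ (n + 1))⁻¹ + a n ^ 2 / (2 * a (n + 1)) =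
      (a (n + 1) + 2 ^ n * a n ^ 2) / (2 ^ (n + 1) * a (n + 1)) := by
    field_simp
    ring
  rw [hrhs, eq_div_iff (mul_ne_zero (by positivity) h)]
  constructor <;> intro heq <;> linarith

theorem IsSelfSimilarCoefficients.pos_of_lt (ha : IsSelfSimilarCoefficients a)
    (hpos : 0 < a (n₀ + 1)) (hn : n₀ < n) : 0 < a n := by
  induction n, Nat.succ_le_of_lt hn using Nat.le_induction with
  | base => exact hpos
  | succ n hle ih =>
    obtain ⟨k, rfl⟩ := Nat.exists_eq_add_of_le' (Nat.one_le_of_lt hle)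
    have hk := ih hle
    rw [(neg_succ_eq_iff_add_two_eq hk.ne').1 (ha.neg_succ k)]
    positivity

theorem IsCoefficientSequence.isSelfSimilarCoefficients (ha : IsCoefficientSequence n₀ a) :
    IsSelfSimilarCoefficients a where
  zero := ha.eq_zero 0 n₀.zero_le
  neg_succ n := by
    rcases lt_or_ge n n₀ with hn | hn
    · simp only [ha.eq_zero n hn.le, ha.eq_zero (n + 1) hn, neg_zero, ne_eq, OfNat.ofNat_ne_zero,
        not_false_eq_true, zero_pow, mul_zero, zero_mul, sub_self]
    · exact (neg_succ_eq_iff_add_two_eq (ha.pos_of_lt (Nat.lt_succ_of_le hn)).ne').2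
        (ha.recurrence (n + 1) (Nat.succ_le_succ hn))

theorem IsSelfSimilarCoefficients.isCoefficientSequence (ha : IsSelfSimilarCoefficients a)
    (hnonneg : 0 ≤ a (n₀ + 1)) (h : StartsAfter n₀ a) : IsCoefficientSequence n₀ a := by
  have hpos : 0 < a (n₀ + 1) := hnonneg.lt_of_ne' h.2
  refine ⟨fun n hn => ?_, hpos, fun n hn => ?_⟩
  · rcases n.eq_zero_or_pos with rfl | hn'
    · exact ha.zero
    · exact h.1 n hn' hn
  · obtain ⟨k, rfl⟩ := Nat.exists_eq_add_of_le' (Nat.one_le_of_lt hn)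
    exact (neg_succ_eq_iff_add_two_eq (ha.pos_of_lt hpos hn).ne').1 (ha.neg_succ k)

theorem isPositiveSolution_selfSimilar_iff (ht₀ : t₀ < 0) :
    IsPositiveSolution (selfSimilar t₀ a) ∧ StartsAfter n₀ a ↔ IsCoefficientSequence n₀ a := by
  constructor
  · rintro ⟨⟨hsol, hnonneg⟩, hstart⟩
    have ha := isSelfSimilarCoefficients_of_isComponentwiseSolutionOn hsol self_mem_Ici ht₀.ne'
      (uniqueDiffOn_Ici 0 0 self_mem_Ici)
    have hfirst : 0 * (0 - t₀) ≤ a (n₀ + 1) :=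
      (le_div_iff₀ (sub_pos.2 ht₀)).1 (hnonneg 0 le_rfl (n₀ + 1))
    rw [zero_mul] at hfirst
    exact ha.isCoefficientSequence hfirst hstart
  · intro ha
    exact ⟨⟨ha.isSelfSimilarCoefficients.isComponentwiseSolutionOn ht₀.not_ge,
      fun t ht n => div_nonneg (ha.nonneg n) (sub_nonneg.2 (ht₀.le.trans ht))⟩,
      fun n _ hn => ha.eq_zero n hn, ha.pos.ne'⟩

theorem hasFiniteEnergy_selfSimilar_iff (ht₀ : t₀ ≠ 0) :
    HasFiniteEnergy (selfSimilar t₀ a) ↔ SquareSummable a := by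
  have hdiv (t : ℝ) : SquareSummable (fun n => selfSimilar t₀ a n t) ↔
      Summable fun n => a n ^ 2 / (t - t₀) ^ 2 := by
    simp only [SquareSummable, selfSimilar, div_pow]
  refine ⟨fun h => ?_, fun h t _ => (hdiv t).2 (h.div_const _)⟩
  exact (summable_div_const_iff (pow_ne_zero 2 (sub_ne_zero.2 ht₀.symm))).1
    ((hdiv 0).1 (h 0 le_rfl))

theorem isPositiveSolution_hasFiniteEnergy_selfSimilar_iff (ht₀ : t₀ < 0) :
    IsPositiveSolution (selfSimilar t₀ a) ∧ HasFiniteEnergy (selfSimilar t₀ a) ∧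
        StartsAfter n₀ a ↔
      a = finiteEnergyCoeff n₀ := by
  rw [and_left_comm, isPositiveSolution_selfSimilar_iff ht₀,
    hasFiniteEnergy_selfSimilar_iff ht₀.ne]
  constructor
  · rintro ⟨hs, ha⟩
    exact ha.squareSummable_iff_eq.1 hs
  · rintro rfl
    exact ⟨squareSummable_finiteEnergyCoeff n₀, isCoefficientSequence_finiteEnergyCoeff n₀⟩

theorem isComponentwiseSolutionOn_Ioi_finiteEnergyCoeff (t₀ : ℝ) (n₀ : ℕ) :
    IsComponentwiseSolutionOn (Ioi t₀) (selfSimilar t₀ (finiteEnergyCoeff n₀)) :=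
  (isCoefficientSequence_finiteEnergyCoeff n₀).isSelfSimilarCoefficients.isComponentwiseSolutionOn
    self_notMem_Ioi

end SelfSimilarSolutions

theorem mainTheorem1 :
    ∃ (d : ℤ → ℝ) (R : ℝ) (h : ℝ → ℝ) (γ : ℝ),
      -- the coefficients `d_k`, the radius `R` and the function `h`
      (IsSeriesCoefficients d ∧ (∀ d', IsSeriesCoefficients d' → d' = d) ∧
        (∀ k : ℤ, 0 ≤ k → 0 ≤ d k)) ∧
      (R ∈ Ioo (4 / 5 : ℝ) 1 ∧
        convergenceRadius (fun k : ℕ => d k) = ENNReal.ofReal R) ∧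
      ((∀ x ∈ Ioo 0 R, HasSum (fun k : ℕ => d k * x ^ k) (x⁻¹ - h x)) ∧
        StrictAntiOn h (Ioc 0 R) ∧ BijOn h (Ioc 0 R) (Ici 0)) ∧
      γ = h (beta ^ 2 * R) ∧
      -- existence and uniqueness of the finite energy positive self-similar solutions
      (∀ t₀ : ℝ, t₀ < 0 → ∀ n₀ : ℕ,
        (∃! a : ℕ → ℝ, IsPositiveSolution (selfSimilar t₀ a) ∧
          HasFiniteEnergy (selfSimilar t₀ a) ∧ StartsAfter n₀ a) ∧
        ∀ a : ℕ → ℝ, IsPositiveSolution (selfSimilar t₀ a) →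
          HasFiniteEnergy (selfSimilar t₀ a) → StartsAfter n₀ a →
          IsComponentwiseSolutionOn (Ioi t₀) (selfSimilar t₀ a) ∧
          (∀ n, n₀ < n → a n = (2 ^ n)⁻¹ * h (beta ^ (2 * (n - n₀)) * R)) ∧
          Tendsto (fun n => a n / waveNumber n ^ (-(1 / 3) : ℝ)) atTop
            (𝓝 (beta ^ (2 * n₀) / R))) ∧
      -- all positive self-similar solutions, of finite energy or not
      (∀ t₀ : ℝ, t₀ < 0 → ∀ (n₀ : ℕ) (a : ℕ → ℝ),
        (IsPositiveSolution (selfSimilar t₀ a) ∧ StartsAfter n₀ a) ↔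
          IsCoefficientSequence n₀ a) ∧
      -- square summability singles out exactly one value of `ã_1`
      (∀ (n₀ : ℕ) (γ' : ℝ),
        (∀ a, IsCoefficientSequence n₀ a → (SquareSummable a ↔ rescaled n₀ a 1 = γ')) ↔
          γ' = γ) ∧
      (∀ (n₀ : ℕ) (a : ℕ → ℝ), IsCoefficientSequence n₀ a → SquareSummable a →
        (∀ n, n₀ < n → a n = (2 ^ n)⁻¹ * h (beta ^ (2 * (n - n₀)) * R)) ∧
        a ~[atTop] fun n => beta ^ (2 * n₀) / R * beta ^ n) ∧
      (∀ (n₀ : ℕ) (a : ℕ → ℝ), IsCoefficientSequence n₀ a → ¬ SquareSummable a →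
        DivergesSuperExponentially a ∧ convergenceRadius a = 0) := by
  refine ⟨seriesCoeff, dyadicRadius (beta ^ 2), profile (beta ^ 2), _,
    ⟨isSeriesCoefficients_seriesCoeff, fun _ hd => hd.unique isSeriesCoefficients_seriesCoeff,
      fun _ => seriesCoeff_nonneg⟩,
    ⟨dyadicRadius_beta_sq_mem_Ioo, convergenceRadius_seriesCoeff⟩,
    ⟨fun x hx => hasSum_seriesCoeff (Ioo_subset_Ioc_self hx),
      strictAntiOn_profile beta_sq_mem_Ioo_zero_one, bijOn_profile beta_sq_mem_Ioo_zero_one⟩, rfl,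
    fun t₀ ht₀ n₀ => ⟨?_, fun a hpos hfin hstart => ?_⟩,
    fun t₀ ht₀ n₀ a => isPositiveSolution_selfSimilar_iff ht₀,
    fun n₀ γ' => forall_squareSummable_iff_rescaled_eq_iff,
    fun n₀ a ha hs => ?_, fun n₀ a ha hs => ?_⟩
  · simp only [isPositiveSolution_hasFiniteEnergy_selfSimilar_iff ht₀, existsUnique_eq]
  · obtain rfl := (isPositiveSolution_hasFiniteEnergy_selfSimilar_iff ht₀).1 ⟨hpos, hfin, hstart⟩
    exact ⟨isComponentwiseSolutionOn_Ioi_finiteEnergyCoeff t₀ n₀,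
      fun n hn => finiteEnergyCoeff_of_le hn.le, tendsto_finiteEnergyCoeff_div n₀⟩
  · obtain rfl := ha.squareSummable_iff_eq.1 hs
    exact ⟨fun n hn => finiteEnergyCoeff_of_le hn.le, isEquivalent_finiteEnergyCoeff n₀⟩
  · have hdiv := ha.divergesSuperExponentially fun h => hs (ha.squareSummable_iff_rescaled_eq.2 h)
    exact ⟨hdiv, hdiv.convergenceRadius_eq_zero⟩
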